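/- Let $\mathbb D$ be the unit disc, and let $\psi:[0,1]\to[0,\infty)$ be continuous with $\psi(0)=0$, $\psi(1)>0$, and such that $\psi(x)/x$ is increasing (not necessarily strictly) on $(0,1)$. For $0<\delta\le\psi(1)$ let $\psi^{-1}(\delta)$ be the unique $x\in[0,1]$ with $\psi(x)=\delta$. Put $G_\psi=\{z\in\mathbb D^2:\operatorname{Re}z_1<\psi(|z_2|)\}$ and, for $0<\delta<1$, $p_\delta=(-\delta,0)\in G_\psi$. For a domain $\Omega\subset\mathbb C^d$, $p\in\Omega$, $X\in\mathbb C^d$, define the following metrics. * The Kobayashi–Royden metric is $\kappa_\Omega(p;X)=\inf\{\lambda^{-1}:\lambda>0,\ \exists\,\varphi:\mathbb D\to\Omega\text{ holomorphic},\ \varphi(0)=p,\ \varphi'(0)=\lambda X\}$, and $\kappa^{(2)}_\Omega(p;X)=\inf\{\kappa_\Omega(p;X_1)+\kappa_\Omega(p;X_2):X_1+X_2=X\}$. * $\widetilde\kappa_\Omega$ is the metric, with $\widetilde\kappa_\Omega(p;\alpha X)=|\alpha|\,\widetilde\kappa_\Omega(p;X)$ for $\alpha\in\mathbb C$, whose indicatrix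 $\{X:\widetilde\kappa_\Omega(p;X)<1\}$ at each $p\in\Omega$ is the envelope of holomorphy of $\{X:\kappa_\Omega(p;X)<1\}$. * The Sibony metric is $$S_\Omega(p;X)=\sup_u\Big(\sum_{i,j=1}^d\frac{\partial^2u}{\partial z_i\partial\bar z_j}(p)X_i\bar X_j\Big)^{1/2},$$ where $u$ runs over the functions on $\Omega$ with $0\le u\le1$, $u(p)=0$, $u$ of class $\mathcal C^2$ near $p$ and $\log u$ plurisubharmonic on $\Omega$. **Theorem.** For every $\delta_0<1$ there exist constants $0<c<C$, depending only on $\psi$ and $\delta_0$, such that for all $\delta$ with $0<\delta\le\delta_0$ and $\delta\le\psi(1)$, and all $(x_N,x_T)\in\mathbb C^2$, $$c\left(\frac{\psi^{-1}(\delta)}{\delta}|x_N|+|x_T|\right)\le S_{G_\psi}(p_\delta;(x_N,x_T))\le M_{G_\psi}(p_\delta;(x_N,x_T))\le C\left(\frac{\psi^{-1}(\delta)}{\delta}|x_N|+|x_T|\right),$$ where $M_{G_\psi}$ is either $\kappa^{(2)}_{G_\psi}$ or $\widetilde\kappa_{G_\psi}$. -/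

import Mathlib

open scoped ENNReal

noncomputable section

namespace InvMetric

/-! ### Holomorphic discs and the Kobayashi-Royden metrics

Points and vectors of `ℂ^d` are functions `Fin d → ℂ`; only the topology and the
linear structure of `ℂ^d` are used. Metrics take values in `[0, ∞]`. -/

/-- `φ` restricts to a holomorphic map from the open unit disc into `Ω`. -/
def IsHolDisc {d : ℕ} (Ω : Set (Fin d → ℂ)) (φ : ℂ → Fin d → ℂ) : Prop :=
  DifferentiableOn ℂ φ (Metric.ball 0 1) ∧ Set.MapsTo φ (Metric.ball 0 1) Ω

/-- The Kobayashi-Royden metric: the infimum of `1 / lam` over all `lam > 0` such that some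
holomorphic disc `φ` in `Ω` has `φ 0 = z` and `φ' 0 = lam X`. -/
def kobayashi {d : ℕ} (Ω : Set (Fin d → ℂ)) (z X : Fin d → ℂ) : ℝ≥0∞ :=
  ⨅ (lam : ℝ) (_ : 0 < lam)
    (_ : ∃ φ : ℂ → Fin d → ℂ, IsHolDisc Ω φ ∧ φ 0 = z ∧ deriv φ 0 = lam • X),
    ENNReal.ofReal lam⁻¹

/-- The `m`-th Kobayashi-Royden metric: the infimum of the sums of the Kobayashi-Royden lengths
of the pieces, over all decompositions of `X` into `m` vectors. -/
def kobayashiSum {d : ℕ} (m : ℕ) (Ω : Set (Fin d → ℂ)) (z X : Fin d → ℂ) : ℝ≥0∞ :=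
  ⨅ (Y : Fin m → Fin d → ℂ) (_ : ∑ j, Y j = X), ∑ j, kobayashi Ω z (Y j)

/-! ### The metric whose indicatrices are envelopes of holomorphy -/

/-- The indicatrix (open unit ball) of the Kobayashi-Royden metric at `z`. -/
def kobayashiIndicatrix {d : ℕ} (Ω : Set (Fin d → ℂ)) (z : Fin d → ℂ) : Set (Fin d → ℂ) :=
  {X | kobayashi Ω z X < 1}

/-- The (single-sheeted) envelope of holomorphy of a domain `U` of `ℂ^d`: the largest domain
containing `U` to which every holomorphic function on `U` extends holomorphically, written as
the union of all such domains. For balanced domains, such as the indicatrix of the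
Kobayashi-Royden metric, the envelope of holomorphy is single-sheeted, so this is the usual
envelope. -/
def envelopeOfHolomorphy {d : ℕ} (U : Set (Fin d → ℂ)) : Set (Fin d → ℂ) :=
  ⋃₀ {V | IsOpen V ∧ IsConnected V ∧ U ⊆ V ∧
    ∀ f : (Fin d → ℂ) → ℂ, DifferentiableOn ℂ f U →
      ∃ g : (Fin d → ℂ) → ℂ, DifferentiableOn ℂ g V ∧ Set.EqOn g f U}

/-- The metric (homogeneous function of `X`) whose indicatrix at `z` is the envelope of
holomorphy of the Kobayashi-Royden indicatrix at `z`. -/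
def kobayashiTilde {d : ℕ} (Ω : Set (Fin d → ℂ)) (z X : Fin d → ℂ) : ℝ≥0∞ :=
  ⨅ (t : ℝ) (_ : 0 < t) (_ : t⁻¹ • X ∈ envelopeOfHolomorphy (kobayashiIndicatrix Ω z)),
    ENNReal.ofReal t

/-! ### Plurisubharmonic functions with values in `[-∞, ∞)` -/

/-- The mean over the circle of centre `a` and radius `r` of a function that is bounded above
there: the mean of the positive part minus the (possibly infinite) mean of the negative part. -/
def circleMean (v : ℂ → EReal) (a : ℂ) (r : ℝ) : EReal :=
  ((⨍⁻ θ in Set.Ioc 0 (2 * Real.pi), (v (circleMap a r θ)).toENNReal ∂MeasureTheory.volume :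
      ℝ≥0∞) : EReal) -
    ((⨍⁻ θ in Set.Ioc 0 (2 * Real.pi), (-v (circleMap a r θ)).toENNReal ∂MeasureTheory.volume :
      ℝ≥0∞) : EReal)

/-- Subharmonic functions on an open set `U` of the plane: upper semicontinuous, with values
in `[-∞, ∞)`, and with the sub-mean value property on all small circles about each point. The
constant `-∞` is allowed. -/
def SubharmonicOn (v : ℂ → EReal) (U : Set ℂ) : Prop :=
  UpperSemicontinuousOn v U ∧ (∀ a ∈ U, v a ≠ ⊤) ∧
    ∀ a ∈ U, ∃ ρ > 0, ∀ r, 0 < r → r < ρ → v a ≤ circleMean v a r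

/-- Plurisubharmonic functions on an open set `Ω` of `ℂ^d`: upper semicontinuous, and
subharmonic along every holomorphic disc in `Ω`. -/
def PlurisubharmonicOn {d : ℕ} (v : (Fin d → ℂ) → EReal) (Ω : Set (Fin d → ℂ)) : Prop :=
  UpperSemicontinuousOn v Ω ∧
    ∀ φ : ℂ → Fin d → ℂ, IsHolDisc Ω φ → SubharmonicOn (v ∘ φ) (Metric.ball 0 1)

/-! ### The Sibony metric -/

/-- The derivative `∂ f / ∂ z_i`. -/
def wirtinger {d : ℕ} (i : Fin d) (f : (Fin d → ℂ) → ℂ) (z : Fin d → ℂ) : ℂ :=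
  (1 / 2) * (fderiv ℝ f z (Pi.single i 1) - Complex.I * fderiv ℝ f z (Pi.single i Complex.I))

/-- The derivative `∂ f / ∂ z̄_i`. -/
def wirtingerBar {d : ℕ} (i : Fin d) (f : (Fin d → ℂ) → ℂ) (z : Fin d → ℂ) : ℂ :=
  (1 / 2) * (fderiv ℝ f z (Pi.single i 1) + Complex.I * fderiv ℝ f z (Pi.single i Complex.I))

/-- The Levi form `∑ i j, (∂² u / ∂ z_i ∂ z̄_j)(p) X_i X̄_j` of a real function that is `C²`
near `p` (the sum is then a real number). -/
def leviForm {d : ℕ} (u : (Fin d → ℂ) → ℝ) (p X : Fin d → ℂ) : ℝ :=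
  (∑ i, ∑ j, wirtinger i (wirtingerBar j (fun z => (u z : ℂ))) p * X i *
    (starRingEnd ℂ) (X j)).re

/-- The competitors in the Sibony metric at `p`: `0 ≤ u ≤ 1` on `Ω`, `u p = 0`, `u` is `C²` near
`p`, and `log u` (with `log 0 = -∞`) is plurisubharmonic on `Ω`; in particular `u` itself is
plurisubharmonic. -/
structure SibonyAdmissible {d : ℕ} (Ω : Set (Fin d → ℂ)) (p : Fin d → ℂ)
    (u : (Fin d → ℂ) → ℝ) : Prop where
  nonneg : ∀ z ∈ Ω, 0 ≤ u z
  le_one : ∀ z ∈ Ω, u z ≤ 1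
  apply_eq_zero : u p = 0
  contDiffAt : ContDiffAt ℝ 2 u p
  log_psh : PlurisubharmonicOn (fun z => ENNReal.log (ENNReal.ofReal (u z))) Ω

/-- The Sibony metric: the supremum of the square roots of the Levi forms at `p` of the
competitors. -/
def sibony {d : ℕ} (Ω : Set (Fin d → ℂ)) (p X : Fin d → ℂ) : ℝ≥0∞ :=
  ⨆ (u : (Fin d → ℂ) → ℝ) (_ : SibonyAdmissible Ω p u),
    ENNReal.ofReal (Real.sqrt (leviForm u p X))

/-! ### The model domains -/

/-- The domain `{z ∈ 𝔻² : Re z₁ < ψ(|z₂|)}`. -/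
def modelDomain (ψ : ℝ → ℝ) : Set (Fin 2 → ℂ) :=
  {z | ‖z 0‖ < 1 ∧ ‖z 1‖ < 1 ∧ (z 0).re < ψ ‖z 1‖}

/-- The point `p_δ = (-δ, 0)`. -/
def basePoint (δ : ℝ) : Fin 2 → ℂ := ![-(δ : ℂ), 0]

/-- The inverse of `ψ : [0, 1] → [0, ∞)`. -/
def profileInv (ψ : ℝ → ℝ) (δ : ℝ) : ℝ := Function.invFunOn ψ (Set.Icc 0 1) δ

/-- The comparison quantity `(ψ⁻¹(δ) / δ) |x_N| + |x_T|`. -/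
def modelSize (ψ : ℝ → ℝ) (δ : ℝ) (xN xT : ℂ) : ℝ :=
  profileInv ψ δ / δ * ‖xN‖ + ‖xT‖

end InvMetric

end

noncomputable section

namespace InvMetric

open Set Filter Topology Metric MeasureTheory Asymptotics

/-! ### Circle means and subharmonic functions -/

/-! Write `x = ψ⁻¹(δ)`. There are three independent estimates.

Lower bound: an explicit Sibony competitor, `candidate`. On `|z₂| < x/2`, monotonicity of `ψ(t)/t`
forces `Re z₁ < δ/2`, so `(z₁ + δ)/(z₁ - δ)` is bounded by 3 there, and `|z₂|²/16 + (x/40)² |(z₁ +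
δ)/(z₁ - δ)|²` has a Levi form of the right size at the base point. It is glued by a maximum to
`|z₂|^k`, with `k` slightly above 2. The power dominates for `x/4 ≤ |z₂| < x/2`, where the pieces
must match, and is negligible near the base point, so that the Levi form there is that of the first
function (`leviForm_candidate`).

Comparison with `M`: along a holomorphic disc a competitor satisfies `u(φ(z)) ≤ |z|²` by a Schwarz
lemma (`le_norm_sq_of_log_subharmonicOn`), so its Levi form is at most 1 on `φ'(0)`
(`SibonyAdmissible.leviBilin_le_one`). The Levi form is positive semidefinite Hermitian. Its square
root is therefore subadditive, which handles `κ⁽²⁾`; and its unit ball is cut out by complex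
hyperplanes that the indicatrix misses, so the envelope of holomorphy stays inside it, which handles
`κ̃`.

Upper bound: the affine discs through `p_δ` in directions with `|y₀| ≤ b |y₁|`, where `b` is
comparable to `δ/x`, lie in the domain (`kobayashi_modelDomain_le`). Every vector is a sum of two
such directions, which bounds `κ⁽²⁾`. These directions together with a neighbourhood of 0 contain a
Hartogs figure whose envelope contains a bidisc (`bidisc_subset_envelopeOfHolomorphy`), which bounds
`κ̃`. -/

theorem circleMean_mono {v w : ℂ → EReal} {a : ℂ} {r : ℝ}
    (h : ∀ z ∈ sphere a |r|, v z ≤ w z) : circleMean v a r ≤ circleMean w a r := by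
  have h' : ∀ θ : ℝ, v (circleMap a r θ) ≤ w (circleMap a r θ) := fun θ =>
    h _ (circleMap_mem_sphere' a r θ)
  unfold circleMean
  refine EReal.sub_le_sub ?_ ?_
  · exact EReal.coe_ennreal_le_coe_ennreal_iff.2
      (setLAverage_mono_ae _ (ae_of_all _ fun θ => EReal.toENNReal_le_toENNReal (h' θ)))
  · exact EReal.coe_ennreal_le_coe_ennreal_iff.2
      (setLAverage_mono_ae _ (ae_of_all _ fun θ =>
        EReal.toENNReal_le_toENNReal (EReal.neg_le_neg_iff.2 (h' θ))))

theorem circleMean_coe {h : ℂ → ℝ} {a : ℂ} {r : ℝ} (hc : ContinuousOn h (sphere a |r|)) :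
    circleMean (fun z => (h z : EReal)) a r = ((Real.circleAverage h a r : ℝ) : EReal) := by
  have hcont : Continuous fun θ : ℝ => h (circleMap a r θ) :=
    hc.comp_continuous (continuous_circleMap a r) fun θ => circleMap_mem_sphere' a r θ
  have hint : IntegrableOn (fun θ : ℝ => h (circleMap a r θ)) (Ioc 0 (2 * Real.pi)) :=
    (hcont.integrableOn_Icc).mono_set Ioc_subset_Icc_self
  have hfin : ∀ g : ℝ → ℝ, IntegrableOn g (Ioc 0 (2 * Real.pi)) →
      ∫⁻ θ in Ioc 0 (2 * Real.pi), ENNReal.ofReal (g θ) ≠ ⊤ := fun g hg =>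
    (lintegral_ofReal_le_lintegral_enorm g |>.trans_lt hg.2).ne
  have h2 : (0 : ℝ) < 2 * Real.pi := Real.two_pi_pos
  have hpos := hfin _ hint
  have hneg := hfin _ hint.neg
  have key := integral_eq_lintegral_pos_part_sub_lintegral_neg_part hint
  unfold circleMean
  simp only [← EReal.coe_neg, EReal.real_coe_toENNReal]
  rw [setLAverage_eq, setLAverage_eq, Real.volume_Ioc, sub_zero,
    Real.circleAverage_def, intervalIntegral.integral_of_le h2.le, key]
  simp only [Pi.neg_apply] at hneg
  lift ∫⁻ θ in Ioc 0 (2 * Real.pi), ENNReal.ofReal (h (circleMap a r θ)) to NNReal using hpos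
    with P
  lift ∫⁻ θ in Ioc 0 (2 * Real.pi), ENNReal.ofReal (-h (circleMap a r θ)) to NNReal using hneg
    with N
  rw [← ENNReal.ofReal_coe_nnreal, ← ENNReal.ofReal_coe_nnreal (p := N),
    ← ENNReal.ofReal_div_of_pos h2, ← ENNReal.ofReal_div_of_pos h2,
    EReal.coe_ennreal_ofReal, EReal.coe_ennreal_ofReal, ← EReal.coe_sub,
    max_eq_left (by positivity), max_eq_left (by positivity), smul_eq_mul,
    ENNReal.toReal_ofReal P.coe_nonneg, ENNReal.toReal_ofReal N.coe_nonneg]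
  congr 1
  field_simp

/-- Harmonicity of `log |g|` for zero-free `g`. Every sub-mean value argument below is reduced by
monotonicity to this explicit mean, so means of functions taking the value `-∞` are never split. -/
theorem circleMean_log_norm {g : ℂ → ℂ} {a : ℂ} {r : ℝ}
    (hg : AnalyticOnNhd ℂ g (closedBall a |r|)) (h0 : ∀ z ∈ closedBall a |r|, g z ≠ 0)
    (k c : ℝ) :
    circleMean (fun z => ((k * Real.log ‖g z‖ + c : ℝ) : EReal)) a r =
      ((k * Real.log ‖g a‖ + c : ℝ) : EReal) := by
  have hlog : ContinuousOn (fun z => Real.log ‖g z‖) (sphere a |r|) := fun z hz =>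
    ((hg z (sphere_subset_closedBall hz)).continuousAt.norm.log
      (norm_ne_zero_iff.2 (h0 z (sphere_subset_closedBall hz)))).continuousWithinAt
  have hmul : ContinuousOn (fun z => k * Real.log ‖g z‖) (sphere a |r|) :=
    continuousOn_const.mul hlog
  rw [circleMean_coe (h := fun z => k * Real.log ‖g z‖ + c) (hmul.add continuousOn_const)]
  have h1 : Real.circleAverage (fun z => k * Real.log ‖g z‖ + c) a r =
      Real.circleAverage (fun z => k * Real.log ‖g z‖) a r + c := by
    have := Real.circleAverage_fun_add hmul.circleIntegrable'
      (continuousOn_const (c := c)).circleIntegrable'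
    rw [this, Real.circleAverage_const]
  have h2 : Real.circleAverage (fun z => k * Real.log ‖g z‖) a r =
      k * Real.circleAverage (fun z => Real.log ‖g z‖) a r := by
    simpa [smul_eq_mul] using
      Real.circleAverage_fun_smul (a := k) (f := fun z => Real.log ‖g z‖) (c := a) (R := r)
  rw [h1, h2, hg.circleAverage_log_norm_of_ne_zero h0]

/-- The sub-mean value inequality at `a` for a function with a minorant `k log |g|`, `g`
holomorphic, that touches it at `a`. -/
theorem exists_le_circleMean_of_log_norm_le {v : ℂ → EReal} {g : ℂ → ℂ} {a : ℂ} {k : ℝ}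
    (hg : AnalyticAt ℂ g a) (h0 : g a ≠ 0) (ha : v a ≤ ((k * Real.log ‖g a‖ : ℝ) : EReal))
    (hv : ∀ᶠ z in 𝓝 a, ((k * Real.log ‖g z‖ : ℝ) : EReal) ≤ v z) :
    ∃ ρ > 0, ∀ r, 0 < r → r < ρ → v a ≤ circleMean v a r := by
  obtain ⟨ρ, hρ, h⟩ := Metric.eventually_nhds_iff_ball.1
    ((hg.eventually_analyticAt.and (hg.continuousAt.eventually_ne h0)).and hv)
  refine ⟨ρ, hρ, fun r hr hrρ => ?_⟩
  have hsub : closedBall a |r| ⊆ ball a ρ := closedBall_subset_ball (by rwa [abs_of_pos hr])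
  have := circleMean_log_norm (g := g) (a := a) (r := r) (fun z hz => (h z (hsub hz)).1.1)
    (fun z hz => (h z (hsub hz)).1.2) k 0
  calc v a ≤ ((k * Real.log ‖g a‖ + 0 : ℝ) : EReal) := by rwa [add_zero]
    _ = _ := this.symm
    _ ≤ _ := circleMean_mono fun z hz => by
      simpa using (h z (hsub (sphere_subset_closedBall hz))).2

theorem log_ofReal_le_coe {x y : ℝ} :
    ENNReal.log (ENNReal.ofReal x) ≤ (y : EReal) ↔ x ≤ Real.exp y := by
  rcases le_or_gt x 0 with hx | hx
  · rw [ENNReal.log_ofReal, if_pos hx]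
    simp [hx.trans (Real.exp_pos y).le]
  · rw [ENNReal.log_ofReal_of_pos hx, EReal.coe_le_coe_iff, Real.log_le_iff_le_exp hx]

/-! ### A Schwarz lemma for logarithmically subharmonic functions -/

/-- Maximum principle on an annulus for `log v - k log |z| + η |z|²`. Since `k < 2`, the growth
condition makes this function small on a small inner circle; the term with `η > 0` makes it strictly
subharmonic and excludes an interior maximum. -/
theorem le_of_log_subharmonicOn_aux {v : ℂ → ℝ} (h1 : ∀ z ∈ ball (0 : ℂ) 1, v z ≤ 1)
    (hsub : SubharmonicOn (fun z => ENNReal.log (ENNReal.ofReal (v z))) (ball 0 1))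
    {K : ℝ} (hK : ∀ᶠ z in 𝓝 (0 : ℂ), v z ≤ K * ‖z‖ ^ 2)
    {R k η : ℝ} (hR : R < 1) (hk0 : 0 < k) (hk : k < 2) (hη : 0 < η)
    {b : ℂ} (hb0 : b ≠ 0) (hbR : ‖b‖ ≤ R) :
    v b ≤ Real.exp (k * Real.log ‖b‖ - k * Real.log R + η * R ^ 2) := by
  by_contra! hcon
  set L : ℝ := -(k * Real.log R) + η * R ^ 2 with hL
  set s : ℂ → ℝ := fun z => -(k * Real.log ‖z‖) + η * ‖z‖ ^ 2 with hs
  set w : ℂ → EReal := fun z => ENNReal.log (ENNReal.ofReal (v z)) + (s z : EReal) with hw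
  have hbpos : 0 < ‖b‖ := norm_pos_iff.2 hb0
  have hvb : 0 < v b := (Real.exp_pos _).trans hcon
  have le_iff : ∀ z (y : ℝ), w z ≤ (y : EReal) ↔ v z ≤ Real.exp (y - s z) := by
    intro z y
    rw [← log_ofReal_le_coe, EReal.coe_sub, hw]
    exact (EReal.le_sub_iff_add_le (Or.inl (EReal.coe_ne_bot _)) (Or.inl (EReal.coe_ne_top _))).symm
  have hwb : ¬ w b ≤ (L : EReal) := by
    rw [le_iff, not_le]
    refine lt_of_le_of_lt (Real.exp_le_exp.2 ?_) hcon
    simp only [hL, hs]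
    nlinarith [sq_nonneg ‖b‖]
  -- a small circle where the comparison function is small
  obtain ⟨ε, hε, hεb, hεsmall⟩ : ∃ ε > 0, ε < ‖b‖ ∧ ∀ z : ℂ, ‖z‖ = ε → w z ≤ (L : EReal) := by
    have ht : Tendsto (fun t : ℝ => K * t ^ (2 - k)) (𝓝[>] 0) (𝓝 (K * 0)) := by
      refine Tendsto.const_mul K ?_
      have := (Real.continuousAt_rpow_const 0 (2 - k) (Or.inr (by linarith))).tendsto
      rw [Real.zero_rpow (by linarith)] at this
      exact this.mono_left nhdsWithin_le_nhds
    have e1 : ∀ᶠ t : ℝ in 𝓝[>] 0, K * t ^ (2 - k) < Real.exp (L - η) :=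
      ht.eventually (gt_mem_nhds (by rw [mul_zero]; exact Real.exp_pos _))
    obtain ⟨ρ, hρ, hKρ⟩ := Metric.eventually_nhds_iff_ball.1 hK
    have e2 : ∀ᶠ t : ℝ in 𝓝[>] 0, t < ‖b‖ := nhdsWithin_le_nhds (gt_mem_nhds hbpos)
    have e3 : ∀ᶠ t : ℝ in 𝓝[>] 0, t < ρ := nhdsWithin_le_nhds (gt_mem_nhds hρ)
    have e4 : ∀ᶠ t : ℝ in 𝓝[>] 0, 0 < t := self_mem_nhdsWithin
    obtain ⟨t, h1, h2, h3, h4⟩ := (e1.and (e2.and (e3.and e4))).exists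
    refine ⟨t, h4, h2, fun z hz => ?_⟩
    rw [le_iff]
    refine (hKρ z (by simpa [hz] using h3)).trans ?_
    have hexp : Real.exp (L - s z) = Real.exp (L - η * t ^ 2) * t ^ k := by
      simp only [hs, hz, Real.rpow_def_of_pos h4, ← Real.exp_add]
      congr 1; ring
    have ht1 : t ≤ 1 := by linarith
    have hsplit : t ^ 2 = t ^ (2 - k) * t ^ k := by
      rw [← Real.rpow_add h4]; norm_num
    rw [hexp, hz]
    calc K * t ^ 2 = (K * t ^ (2 - k)) * t ^ k := by rw [hsplit]; ring
      _ ≤ Real.exp (L - η) * t ^ k := by gcongr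
      _ ≤ _ := by
        gcongr
        nlinarith [mul_le_mul_of_nonneg_left (pow_le_one₀ h4.le ht1 (n := 2)) hη.le]
  set A : Set ℂ := closedBall 0 R \ ball 0 ε with hA
  have hAmem : ∀ z, z ∈ A ↔ ‖z‖ ≤ R ∧ ε ≤ ‖z‖ := by
    intro z; simp [hA]
  have hAc : IsCompact A := (isCompact_closedBall _ _).diff isOpen_ball
  have hA0 : ∀ z ∈ A, z ≠ 0 := fun z hz => norm_pos_iff.1 (hε.trans_le ((hAmem z).1 hz).2)
  have hA1 : A ⊆ ball 0 1 := fun z hz => by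
    simpa using ((hAmem z).1 hz).1.trans_lt hR
  have hscont : ContinuousOn s A := fun z hz => by
    have : ContinuousAt s z := by
      have := (continuous_norm.continuousAt (x := z)).log (norm_ne_zero_iff.2 (hA0 z hz))
      fun_prop
    exact this.continuousWithinAt
  have husc : UpperSemicontinuousOn w A := by
    refine UpperSemicontinuousOn.add' (hsub.1.mono hA1)
      (continuous_coe_real_ereal.comp_continuousOn hscont).upperSemicontinuousOn fun z _ => ?_
    exact EReal.continuousAt_add (Or.inr (EReal.coe_ne_bot _)) (Or.inr (EReal.coe_ne_top _))
  have hbA : b ∈ A := (hAmem b).2 ⟨hbR, hεb.le⟩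
  obtain ⟨a, haA, hamax⟩ := UpperSemicontinuousOn.exists_isMaxOn ⟨b, hbA⟩ hAc husc
  have hwa : ¬ w a ≤ (L : EReal) := fun h => hwb ((hamax hbA).trans h)
  have haε : ε < ‖a‖ := lt_of_le_of_ne ((hAmem a).1 haA).2 fun h => hwa (hεsmall a h.symm)
  have haR : ‖a‖ < R := by
    refine lt_of_le_of_ne ((hAmem a).1 haA).1 fun h => hwa ?_
    rw [le_iff]
    have : L - s a = 0 := by simp only [hL, hs, h]; ring
    rw [this, Real.exp_zero]
    exact h1 a (hA1 haA)
  have hva : 0 < v a := by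
    by_contra! h
    exact hwa (by rw [le_iff]; exact h.trans (Real.exp_pos _).le)
  set m : ℝ := Real.log (v a) with hm
  have hlogva : ENNReal.log (ENNReal.ofReal (v a)) = (m : EReal) := ENNReal.log_ofReal_of_pos hva
  obtain ⟨ρ, hρ, hmean⟩ := hsub.2.2 a (hA1 haA)
  obtain ⟨r, hr, hrlt⟩ := exists_between
    (lt_min hρ (lt_min (sub_pos.2 haε) (sub_pos.2 haR)))
  have hrρ : r < ρ := hrlt.trans_le (min_le_left _ _)
  have hrε : r < ‖a‖ - ε := hrlt.trans_le ((min_le_right _ _).trans (min_le_left _ _))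
  have hrR : r < R - ‖a‖ := hrlt.trans_le ((min_le_right _ _).trans (min_le_right _ _))
  -- On the circle `|z - a| = r` one has `|z|² = |a|² + r² + 2 Re (ā (z - a))`, so there `k log |z|
  -- - η |z|²` agrees with the harmonic function `k log |g|` up to a constant. The mean is then
  -- exact, and `η r²` is the contradiction.
  set g : ℂ → ℂ := fun z => z * Complex.exp (-(2 * η / k * ((starRingEnd ℂ) a * (z - a)))) with hg
  have hgan : AnalyticOnNhd ℂ g (closedBall a |r|) :=
    DifferentiableOn.analyticOnNhd (s := univ) (by fun_prop) isOpen_univ |>.mono (subset_univ _)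
  have hball : ∀ z ∈ closedBall a |r|, z ∈ A := by
    intro z hz
    rw [abs_of_pos hr, mem_closedBall, dist_eq_norm] at hz
    rw [hAmem]
    have e1 := norm_sub_norm_le z a
    have e2 := norm_sub_norm_le a z
    rw [norm_sub_rev] at e2
    constructor <;> linarith
  have hgne : ∀ z ∈ closedBall a |r|, g z ≠ 0 := fun z hz =>
    mul_ne_zero (hA0 z (hball z hz)) (Complex.exp_ne_zero _)
  have hglog : ∀ z ∈ A, Real.log ‖g z‖ =
      Real.log ‖z‖ - 2 * η / k * ((starRingEnd ℂ) a * (z - a)).re := by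
    intro z hz
    have hre : (-(2 * η / k * ((starRingEnd ℂ) a * (z - a))) : ℂ).re =
        -(2 * η / k * ((starRingEnd ℂ) a * (z - a)).re) := by
      rw [Complex.neg_re, ← Complex.re_ofReal_mul]
      push_cast
      rfl
    simp only [hg, norm_mul, Complex.norm_exp]
    rw [Real.log_mul (norm_ne_zero_iff.2 (hA0 z hz)) (Real.exp_pos _).ne', Real.log_exp, hre]
    ring
  have hsphere : ∀ z ∈ sphere a |r|, ENNReal.log (ENNReal.ofReal (v z)) ≤
      ((k * Real.log ‖g z‖ + (m + s a - η * (‖a‖ ^ 2 + r ^ 2)) : ℝ) : EReal) := by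
    intro z hz
    have hzA := hball z (sphere_subset_closedBall hz)
    have hle : w z ≤ ((m + s a : ℝ) : EReal) := by
      refine (hamax hzA).trans (le_of_eq ?_)
      rw [hw, EReal.coe_add, ← hlogva]
    rw [le_iff, ← log_ofReal_le_coe] at hle
    refine hle.trans (EReal.coe_le_coe_iff.2 (le_of_eq ?_))
    have hnorm : ‖z‖ ^ 2 = ‖a‖ ^ 2 + r ^ 2 + 2 * ((starRingEnd ℂ) a * (z - a)).re := by
      have hzr : ‖z - a‖ = r := by
        rw [mem_sphere, dist_eq_norm, abs_of_pos hr] at hz; exact hz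
      rw [← hzr, Complex.sq_norm, Complex.sq_norm, Complex.sq_norm]
      simp [Complex.normSq_apply]
      ring
    rw [hglog z hzA]
    simp only [hs, hnorm]
    field_simp
    ring
  have := (hmean r hr hrρ).trans (circleMean_mono hsphere)
  beta_reduce at this
  rw [circleMean_log_norm hgan hgne, hlogva, EReal.coe_le_coe_iff, hglog a haA] at this
  simp only [hs, sub_self, mul_zero, Complex.zero_re] at this
  nlinarith [mul_pos hη (pow_pos hr 2)]

/-- A Schwarz lemma: `v ≤ |z| ^ 2` if `log v` is subharmonic, `0 ≤ v ≤ 1` and `v = O(|z| ^ 2)`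
at the origin. -/
theorem le_norm_sq_of_log_subharmonicOn {v : ℂ → ℝ} (h1 : ∀ z ∈ ball (0 : ℂ) 1, v z ≤ 1)
    (hsub : SubharmonicOn (fun z => ENNReal.log (ENNReal.ofReal (v z))) (ball 0 1))
    {K : ℝ} (hK : ∀ᶠ z in 𝓝 (0 : ℂ), v z ≤ K * ‖z‖ ^ 2) {b : ℂ} (hb : ‖b‖ < 1) :
    v b ≤ ‖b‖ ^ 2 := by
  rcases eq_or_ne b 0 with rfl | hb0
  · simpa using hK.self_of_nhds
  have hbpos : 0 < ‖b‖ := norm_pos_iff.2 hb0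
  have hlim : Tendsto (fun t : ℝ => Real.exp ((2 - t) * Real.log ‖b‖ -
      (2 - t) * Real.log (1 - t) + t * (1 - t) ^ 2)) (𝓝[>] 0) (𝓝 (‖b‖ ^ 2)) := by
    have hc : ContinuousAt (fun t : ℝ => Real.exp ((2 - t) * Real.log ‖b‖ -
        (2 - t) * Real.log (1 - t) + t * (1 - t) ^ 2)) 0 := by
      have : ContinuousAt (fun t : ℝ => Real.log (1 - t)) 0 :=
        ContinuousAt.log (by fun_prop) (by norm_num)
      fun_prop
    have h0 := hc.tendsto
    have hval : Real.exp ((2 - 0) * Real.log ‖b‖ - (2 - 0) * Real.log (1 - 0) + 0 * (1 - 0) ^ 2) =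
        ‖b‖ ^ 2 := by
      simp only [sub_zero, Real.log_one, mul_zero, zero_mul, add_zero]
      rw [two_mul, Real.exp_add, Real.exp_log hbpos, sq]
    rw [hval] at h0
    exact h0.mono_left nhdsWithin_le_nhds
  -- Let the radius tend to 1, the exponent to 2 and the perturbation to 0, all driven by one
  -- parameter `t`.
  refine ge_of_tendsto hlim ?_
  have e1 : ∀ᶠ t : ℝ in 𝓝[>] 0, t < 1 - ‖b‖ := nhdsWithin_le_nhds (gt_mem_nhds (by linarith))
  have e2 : ∀ᶠ t : ℝ in 𝓝[>] 0, 0 < t := self_mem_nhdsWithin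
  filter_upwards [e1, e2] with t ht1 ht0
  exact le_of_log_subharmonicOn_aux h1 hsub hK (R := 1 - t) (k := 2 - t) (η := t)
    (by linarith) (by linarith) (by linarith) ht0 hb0 (by linarith)

/-! ### Second order Taylor expansion at a zero minimum -/

section Taylor

variable {E : Type*} [NormedAddCommGroup E] [NormedSpace ℝ E]

theorem fderiv_eq_zero_of_nonneg {u : E → ℝ} {p : E} (h0 : u p = 0) (hpos : ∀ᶠ z in 𝓝 p, 0 ≤ u z) :
    fderiv ℝ u p = 0 :=
  IsLocalMin.fderiv_eq_zero (hpos.mono fun z hz => by rwa [h0])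

theorem isSymmSndFDerivAt_of_contDiffAt_two {u : E → ℝ} {p : E} (hu : ContDiffAt ℝ 2 u p) :
    IsSymmSndFDerivAt ℝ u p :=
  hu.isSymmSndFDerivAt (by simp)

/-- The first derivative vanishes at the minimum `p`. By symmetry of the second derivative, the
difference has derivative `Du(p + h) - Q h = o(|h|)`, and the mean value inequality integrates this.
-/
theorem taylor_two_isLittleO {u : E → ℝ} {p : E} (hu : ContDiffAt ℝ 2 u p) (h0 : u p = 0)
    (hpos : ∀ᶠ z in 𝓝 p, 0 ≤ u z) :
    (fun h => u (p + h) - fderiv ℝ (fderiv ℝ u) p h h / 2) =o[𝓝 0] fun h => ‖h‖ ^ 2 := by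
  set Q := fderiv ℝ (fderiv ℝ u) p with hQ
  have hdu := fderiv_eq_zero_of_nonneg h0 hpos
  have hsymm := isSymmSndFDerivAt_of_contDiffAt_two hu
  have hd1 : DifferentiableAt ℝ (fderiv ℝ u) p :=
    (hu.fderiv_right (m := 1) (by norm_num)).differentiableAt (by norm_num)
  have hlin : (fun h => fderiv ℝ u (p + h) - Q h) =o[𝓝 0] fun h => h := by
    have := hasFDerivAt_iff_isLittleO_nhds_zero.1 hd1.hasFDerivAt
    simpa [hdu] using this
  have hdiff : ∀ᶠ z in 𝓝 p, DifferentiableAt ℝ u z :=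
    (hu.eventually (by simp)).mono fun z hz => hz.differentiableAt (by norm_num)
  have hdiff0 : ∀ᶠ h in 𝓝 (0 : E), DifferentiableAt ℝ u (p + h) := by
    have : Tendsto (fun h : E => p + h) (𝓝 0) (𝓝 p) := by
      have := (by fun_prop : Continuous fun h : E => p + h).tendsto 0
      simpa using this
    exact this.eventually hdiff
  rw [isLittleO_iff]
  intro c hc
  obtain ⟨r, hr, hball⟩ := Metric.eventually_nhds_iff_ball.1 ((isLittleO_iff.1 hlin hc).and hdiff0)
  filter_upwards [ball_mem_nhds (0 : E) hr] with h hh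
  have hsub : closedBall (0 : E) ‖h‖ ⊆ ball 0 r := closedBall_subset_ball (by simpa using hh)
  have hderiv : ∀ y ∈ closedBall (0 : E) ‖h‖, HasFDerivWithinAt
      (fun h => u (p + h) - Q h h / 2) (fderiv ℝ u (p + y) - Q y) (closedBall 0 ‖h‖) y := by
    intro y hy
    have e1 : HasFDerivAt (fun h => u (p + h)) (fderiv ℝ u (p + y)) y := by
      have := (hball y (hsub hy)).2.hasFDerivAt
      simpa [Function.comp_def] using this.comp y ((hasFDerivAt_id y).const_add p)
    have e2 : HasFDerivAt (fun h => Q h h / 2) (Q y) y := by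
      have := ((Q.hasFDerivAt (x := y)).clm_apply (hasFDerivAt_id y)).mul_const (2⁻¹ : ℝ)
      refine (this.congr_fderiv ?_)
      ext v
      have := hsymm y v
      simp only [id_eq, _root_.smul_apply, _root_.add_apply,
        ContinuousLinearMap.comp_apply, ContinuousLinearMap.flip_apply, smul_eq_mul,
        ContinuousLinearMap.id_apply]
      rw [← hQ] at this
      rw [← this]; ring
    exact (e1.sub e2).hasFDerivWithinAt
  have hbound : ∀ y ∈ closedBall (0 : E) ‖h‖, ‖fderiv ℝ u (p + y) - Q y‖ ≤ c * ‖h‖ := by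
    intro y hy
    refine (hball y (hsub hy)).1.trans ?_
    have : ‖y‖ ≤ ‖h‖ := by simpa using hy
    gcongr
  have := (convex_closedBall (0 : E) ‖h‖).norm_image_sub_le_of_norm_hasFDerivWithin_le hderiv hbound
    (mem_closedBall_self (norm_nonneg h)) (y := h) (by simp)
  simp only [add_zero, h0, map_zero, zero_div, sub_zero] at this
  rw [norm_pow, norm_norm]
  linarith

/-- Used both to bound second derivatives along holomorphic discs and to compute those of the
explicit competitor. -/
theorem tendsto_taylor_two {u : E → ℝ} {p : E} (hu : ContDiffAt ℝ 2 u p) (h0 : u p = 0)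
    (hpos : ∀ᶠ z in 𝓝 p, 0 ≤ u z) {γ : ℝ → E} {Y : E} (hγ : HasDerivAt γ Y 0) (hγ0 : γ 0 = p) :
    Tendsto (fun t => u (γ t) / t ^ 2) (𝓝[≠] 0) (𝓝 (fderiv ℝ (fderiv ℝ u) p Y Y / 2)) := by
  set Q := fderiv ℝ (fderiv ℝ u) p with hQ
  have hslope : Tendsto (fun t : ℝ => t⁻¹ • (γ t - p)) (𝓝[≠] 0) (𝓝 Y) := by
    have := hγ.tendsto_slope_zero
    simpa [hγ0] using this
  have hsub : Tendsto (fun t => γ t - p) (𝓝[≠] 0) (𝓝 0) := by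
    have := (hγ.continuousAt.tendsto.sub_const p).mono_left (nhdsWithin_le_nhds (s := {0}ᶜ))
    simpa [hγ0] using this
  have hQlim : Tendsto (fun t : ℝ => Q (t⁻¹ • (γ t - p)) (t⁻¹ • (γ t - p)) / 2) (𝓝[≠] 0)
      (𝓝 (Q Y Y / 2)) := by
    have hc : Continuous fun z : E => Q z z / 2 := by fun_prop
    exact (hc.tendsto Y).comp hslope
  have hO : (fun t => ‖γ t - p‖ ^ 2) =O[𝓝[≠] 0] fun t : ℝ => t ^ 2 := by
    have h1 : (fun t => γ t - p) =O[𝓝[≠] 0] fun t : ℝ => t := by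
      have := hγ.isBigO_sub
      simpa [hγ0] using this.mono (nhdsWithin_le_nhds (s := {0}ᶜ))
    exact h1.norm_left.pow 2
  have hlittle := ((taylor_two_isLittleO hu h0 hpos).comp_tendsto hsub).trans_isBigO hO
  have hz := hlittle.tendsto_div_nhds_zero
  have := hz.add hQlim
  rw [zero_add] at this
  refine this.congr' ?_
  filter_upwards [self_mem_nhdsWithin] with t ht
  have ht' : t ≠ 0 := ht
  simp only [Function.comp_apply, add_sub_cancel, map_smul, _root_.smul_apply,
    smul_eq_mul]
  field_simp
  ring

theorem isBigO_norm_sq_of_contDiffAt_two {u : E → ℝ} {p : E} (hu : ContDiffAt ℝ 2 u p)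
    (h0 : u p = 0) (hpos : ∀ᶠ z in 𝓝 p, 0 ≤ u z) :
    (fun h => u (p + h)) =O[𝓝 0] fun h => ‖h‖ ^ 2 := by
  have h1 := (taylor_two_isLittleO hu h0 hpos).isBigO
  have h2 : (fun h => fderiv ℝ (fderiv ℝ u) p h h / 2) =O[𝓝 0] fun h => ‖h‖ ^ 2 := by
    refine IsBigO.of_bound (‖fderiv ℝ (fderiv ℝ u) p‖ / 2) (Eventually.of_forall fun h => ?_)
    have := (fderiv ℝ (fderiv ℝ u) p).le_opNorm₂ h h
    rw [norm_div, norm_pow, norm_norm, Real.norm_ofNat]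
    linarith
  simpa using h1.add h2

theorem fderiv_fderiv_nonneg {u : E → ℝ} {p : E} (hu : ContDiffAt ℝ 2 u p) (h0 : u p = 0)
    (hpos : ∀ᶠ z in 𝓝 p, 0 ≤ u z) (Y : E) : 0 ≤ fderiv ℝ (fderiv ℝ u) p Y Y := by
  have hγ : HasDerivAt (fun t : ℝ => p + t • Y) Y 0 := by
    simpa using ((hasDerivAt_id (0 : ℝ)).smul_const Y).const_add p
  have hlim := tendsto_taylor_two hu h0 hpos hγ (by simp)
  have hev : ∀ᶠ t : ℝ in 𝓝[≠] 0, 0 ≤ u (p + t • Y) / t ^ 2 := by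
    have : Tendsto (fun t : ℝ => p + t • Y) (𝓝[≠] 0) (𝓝 p) := by
      simpa using hγ.continuousAt.tendsto.mono_left (nhdsWithin_le_nhds (s := {0}ᶜ))
    filter_upwards [this.eventually hpos] with t ht
    positivity
  have := ge_of_tendsto hlim hev
  linarith

end Taylor

/-! ### The Levi form -/

/-- The real part of the Levi form, polarized: a symmetric real bilinear form. -/
def leviBilin {d : ℕ} (u : (Fin d → ℂ) → ℝ) (p : Fin d → ℂ) :
    LinearMap.BilinForm ℝ (Fin d → ℂ) :=
  LinearMap.mk₂ ℝ (fun X Y => (fderiv ℝ (fderiv ℝ u) p X Y +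
      fderiv ℝ (fderiv ℝ u) p (Complex.I • X) (Complex.I • Y)) / 4)
    (fun _ _ _ => by simp only [smul_add, map_add, _root_.add_apply]; ring)
    (fun c X Y => by
      simp only [smul_comm Complex.I c, map_smul, _root_.smul_apply, smul_eq_mul]
      ring)
    (fun _ _ _ => by simp only [smul_add, map_add]; ring)
    (fun c X Y => by
      simp only [smul_comm Complex.I c, map_smul, smul_eq_mul]
      ring)

theorem leviBilin_apply {d : ℕ} (u : (Fin d → ℂ) → ℝ) (p X Y : Fin d → ℂ) :
    leviBilin u p X Y = (fderiv ℝ (fderiv ℝ u) p X Y +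
      fderiv ℝ (fderiv ℝ u) p (Complex.I • X) (Complex.I • Y)) / 4 := rfl

/-- The polarized Levi form, with values in `ℂ`. -/
def leviSesq {d : ℕ} (u : (Fin d → ℂ) → ℝ) (p X Y : Fin d → ℂ) : ℂ :=
  leviBilin u p X Y + Complex.I * leviBilin u p X (Complex.I • Y)

theorem leviSesq_re {d : ℕ} (u : (Fin d → ℂ) → ℝ) (p X Y : Fin d → ℂ) :
    (leviSesq u p X Y).re = leviBilin u p X Y := by
  simp [leviSesq]

theorem leviBilin_I_smul_left {d : ℕ} (u : (Fin d → ℂ) → ℝ) (p X Y : Fin d → ℂ) :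
    leviBilin u p (Complex.I • X) Y = -leviBilin u p X (Complex.I • Y) := by
  have h : ∀ Z : Fin d → ℂ, Complex.I • Complex.I • Z = -Z := fun Z => by
    rw [smul_smul, Complex.I_mul_I, neg_one_smul]
  simp only [leviBilin_apply, h, map_neg, _root_.neg_apply]
  ring

theorem leviSesq_add_left {d : ℕ} (u : (Fin d → ℂ) → ℝ) (p X X' Y : Fin d → ℂ) :
    leviSesq u p (X + X') Y = leviSesq u p X Y + leviSesq u p X' Y := by
  simp only [leviSesq, map_add, LinearMap.add_apply]
  push_cast
  ring

theorem leviSesq_add_right {d : ℕ} (u : (Fin d → ℂ) → ℝ) (p X Y Y' : Fin d → ℂ) :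
    leviSesq u p X (Y + Y') = leviSesq u p X Y + leviSesq u p X Y' := by
  simp only [leviSesq, smul_add, map_add]
  push_cast
  ring

theorem smul_eq_re_add_im {d : ℕ} (c : ℂ) (X : Fin d → ℂ) :
    c • X = c.re • X + c.im • Complex.I • X := by
  ext i
  simp only [Pi.smul_apply, Pi.add_apply, smul_eq_mul, Complex.real_smul]
  linear_combination (-X i) * (Complex.re_add_im c)

theorem leviSesq_smul_left {d : ℕ} (u : (Fin d → ℂ) → ℝ) (p X Y : Fin d → ℂ) (c : ℂ) :
    leviSesq u p (c • X) Y = c * leviSesq u p X Y := by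
  have hI : leviBilin u p (Complex.I • X) (Complex.I • Y) = leviBilin u p X Y := by
    rw [leviBilin_I_smul_left, smul_smul, Complex.I_mul_I, neg_one_smul, map_neg, neg_neg]
  rw [smul_eq_re_add_im c X]
  simp only [leviSesq, map_add, map_smul, LinearMap.add_apply, LinearMap.smul_apply, hI,
    leviBilin_I_smul_left u p X Y, smul_eq_mul]
  push_cast
  conv_rhs => rw [← Complex.re_add_im c]
  linear_combination (-(c.im : ℂ) * (leviBilin u p X (Complex.I • Y))) * Complex.I_mul_I

theorem leviSesq_smul_right {d : ℕ} (u : (Fin d → ℂ) → ℝ) (p X Y : Fin d → ℂ) (c : ℂ) :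
    leviSesq u p X (c • Y) = (starRingEnd ℂ) c * leviSesq u p X Y := by
  have hI : leviBilin u p X (Complex.I • Complex.I • Y) = -leviBilin u p X Y := by
    rw [smul_smul, Complex.I_mul_I, neg_one_smul, map_neg]
  rw [smul_eq_re_add_im c Y]
  simp only [leviSesq, smul_add, smul_comm Complex.I (_ : ℝ), map_add, map_smul, hI, smul_eq_mul]
  have hc : (starRingEnd ℂ) c = c.re - c.im * Complex.I := by
    apply Complex.ext <;> simp
  rw [hc]
  push_cast
  linear_combination ((c.im : ℂ) * (leviBilin u p X (Complex.I • Y))) * Complex.I_mul_I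

/-- The polarized Levi form as a complex linear functional of its first argument. -/
def leviLinear {d : ℕ} (u : (Fin d → ℂ) → ℝ) (p Y : Fin d → ℂ) : (Fin d → ℂ) →ₗ[ℂ] ℂ where
  toFun X := leviSesq u p X Y
  map_add' X X' := leviSesq_add_left u p X X' Y
  map_smul' c X := leviSesq_smul_left u p X Y c

/-- The outer derivative fills the first slot of the second derivative, as in `leviSesq`, so the
four terms match without invoking symmetry. -/
theorem wirtinger_wirtingerBar {d : ℕ} {u : (Fin d → ℂ) → ℝ} {p : Fin d → ℂ}
    (hu : ContDiffAt ℝ 2 u p) (i j : Fin d) :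
    wirtinger i (wirtingerBar j fun z => (u z : ℂ)) p =
      leviSesq u p (Pi.single i 1) (Pi.single j 1) := by
  set Q := fderiv ℝ (fderiv ℝ u) p with hQ
  have hsingle : (Pi.single i Complex.I : Fin d → ℂ) = Complex.I • Pi.single i 1 := by
    rw [← Pi.single_smul', smul_eq_mul, mul_one]
  have hsingle' : (Pi.single j Complex.I : Fin d → ℂ) = Complex.I • Pi.single j 1 := by
    rw [← Pi.single_smul', smul_eq_mul, mul_one]
  have hd1 : HasFDerivAt (fderiv ℝ u) Q p :=
    ((hu.fderiv_right (m := 1) (by norm_num)).differentiableAt (by norm_num)).hasFDerivAt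
  have hdiff : ∀ᶠ z in 𝓝 p, DifferentiableAt ℝ u z :=
    (hu.eventually (by simp)).mono fun z hz => hz.differentiableAt (by norm_num)
  have hcast : ∀ᶠ z in 𝓝 p, wirtingerBar j (fun z => (u z : ℂ)) z =
      (1 / 2) * ((fderiv ℝ u z (Pi.single j 1) : ℂ) +
        Complex.I * (fderiv ℝ u z (Pi.single j Complex.I) : ℂ)) := by
    filter_upwards [hdiff] with z hz
    have : fderiv ℝ (fun z => (u z : ℂ)) z = Complex.ofRealCLM.comp (fderiv ℝ u z) :=
      (Complex.ofRealCLM.hasFDerivAt.comp z hz.hasFDerivAt).fderiv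
    simp [wirtingerBar, this]
  have happ : ∀ Y : Fin d → ℂ, HasFDerivAt (fun z => (fderiv ℝ u z Y : ℂ))
      (Complex.ofRealCLM.comp (Q.flip Y)) p := by
    intro Y
    have := hd1.clm_apply (hasFDerivAt_const Y p)
    simp only [ContinuousLinearMap.comp_zero, zero_add] at this
    exact Complex.ofRealCLM.hasFDerivAt.comp p this
  have hder := (((happ (Pi.single j 1)).add
    ((happ (Pi.single j Complex.I)).const_mul Complex.I)).const_mul (1 / 2 : ℂ)).congr_of_eventuallyEq
      hcast
  rw [wirtinger, hder.fderiv]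
  simp only [leviSesq, leviBilin_apply, ← hQ, hsingle, hsingle', smul_smul, Complex.I_mul_I,
    neg_one_smul, map_neg, _root_.smul_apply, _root_.add_apply,
    ContinuousLinearMap.comp_apply, ContinuousLinearMap.flip_apply, Complex.ofRealCLM_apply,
    smul_eq_mul]
  push_cast
  ring_nf
  rw [Complex.I_sq]
  ring

theorem leviForm_eq {d : ℕ} {u : (Fin d → ℂ) → ℝ} {p : Fin d → ℂ}
    (hu : ContDiffAt ℝ 2 u p) (X : Fin d → ℂ) : leviForm u p X = leviBilin u p X X := by
  have hl : ∀ (s : Finset (Fin d)) (f : Fin d → Fin d → ℂ) (Y : Fin d → ℂ),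
      leviSesq u p (∑ i ∈ s, f i) Y = ∑ i ∈ s, leviSesq u p (f i) Y := fun s f Y =>
    map_sum (leviLinear u p Y) f s
  have hr : ∀ (s : Finset (Fin d)) (f : Fin d → Fin d → ℂ) (Y : Fin d → ℂ),
      leviSesq u p Y (∑ i ∈ s, f i) = ∑ i ∈ s, leviSesq u p Y (f i) := fun s f Y =>
    map_sum (AddMonoidHom.mk' (leviSesq u p Y) (leviSesq_add_right u p Y)) f s
  have hX : X = ∑ i, X i • (Pi.single i (1 : ℂ) : Fin d → ℂ) := (pi_eq_sum_univ' X).trans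
    (Finset.sum_congr rfl fun i _ => by congr 1)
  rw [← leviSesq_re, leviForm]
  congr 1
  conv_rhs => rw [hX, hl]
  refine Finset.sum_congr rfl fun i _ => ?_
  rw [hr]
  refine Finset.sum_congr rfl fun j _ => ?_
  rw [leviSesq_smul_left, leviSesq_smul_right, wirtinger_wirtingerBar hu]
  ring

section General

variable {d : ℕ} {Ω : Set (Fin d → ℂ)} {p : Fin d → ℂ}

/-! ### The Kobayashi-Royden indicatrix -/

theorem kobayashi_le_of_disc {X : Fin d → ℂ} {lam : ℝ} (hlam : 0 < lam) {φ : ℂ → Fin d → ℂ}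
    (hφ : IsHolDisc Ω φ) (h0 : φ 0 = p) (hd : HasDerivAt φ (lam • X) 0) :
    kobayashi Ω p X ≤ ENNReal.ofReal lam⁻¹ :=
  iInf_le_of_le lam <| iInf_le_of_le hlam <| iInf_le_of_le ⟨φ, hφ, h0, hd.deriv⟩ le_rfl

theorem IsHolDisc.hasDerivAt_zero {φ : ℂ → Fin d → ℂ} (hφ : IsHolDisc Ω φ) :
    HasDerivAt φ (deriv φ 0) 0 :=
  (hφ.1.differentiableAt (ball_mem_nhds 0 one_pos)).hasDerivAt

theorem mem_kobayashiIndicatrix_iff {X : Fin d → ℂ} :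
    X ∈ kobayashiIndicatrix Ω p ↔ ∃ lam : ℝ, 1 < lam ∧ ∃ φ : ℂ → Fin d → ℂ,
      IsHolDisc Ω φ ∧ φ 0 = p ∧ HasDerivAt φ (lam • X) 0 := by
  constructor
  · intro h
    change kobayashi Ω p X < 1 at h
    simp only [kobayashi, iInf_lt_iff] at h
    obtain ⟨lam, hlam, ⟨φ, hφ, h0, hd⟩, hlt⟩ := h
    refine ⟨lam, ?_, φ, hφ, h0, hd ▸ hφ.hasDerivAt_zero⟩
    rw [ENNReal.ofReal_lt_one] at hlt
    exact (inv_lt_one₀ hlam).1 hlt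
  · rintro ⟨lam, hlam, φ, hφ, h0, hd⟩
    refine (kobayashi_le_of_disc (by linarith) hφ h0 hd).trans_lt ?_
    rw [ENNReal.ofReal_lt_one]
    exact inv_lt_one_of_one_lt₀ hlam

theorem zero_mem_kobayashiIndicatrix (hp : p ∈ Ω) : (0 : Fin d → ℂ) ∈ kobayashiIndicatrix Ω p := by
  refine mem_kobayashiIndicatrix_iff.2 ⟨2, by norm_num, fun _ => p,
    ⟨differentiableOn_const _, fun _ _ => hp⟩, rfl, ?_⟩
  rw [smul_zero]
  exact hasDerivAt_const _ _

theorem kobayashi_zero (hp : p ∈ Ω) : kobayashi Ω p 0 = 0 := by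
  refine le_antisymm (ENNReal.le_of_forall_pos_le_add fun ε hε _ => ?_) zero_le
  have hε' : (0 : ℝ) < (ε : ℝ)⁻¹ := inv_pos.2 (NNReal.coe_pos.2 hε)
  have := kobayashi_le_of_disc (Ω := Ω) (p := p) (X := 0) hε' (φ := fun _ => p)
    ⟨differentiableOn_const _, fun _ _ => hp⟩ rfl (by rw [smul_zero]; exact hasDerivAt_const _ _)
  rwa [inv_inv, ENNReal.ofReal_coe_nnreal, ← zero_add (ε : ℝ≥0∞)] at this

theorem smul_mem_kobayashiIndicatrix {X : Fin d → ℂ} (hX : X ∈ kobayashiIndicatrix Ω p) {c : ℝ}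
    (hc0 : 0 ≤ c) (hc1 : c ≤ 1) : c • X ∈ kobayashiIndicatrix Ω p := by
  obtain ⟨lam, hlam, φ, hφ, h0, hd⟩ := mem_kobayashiIndicatrix_iff.1 hX
  have hmaps : MapsTo (fun z : ℂ => (c : ℂ) * z) (ball 0 1) (ball 0 1) := fun z hz => by
    rw [mem_ball_zero_iff] at hz ⊢
    rw [norm_mul, Complex.norm_real, Real.norm_of_nonneg hc0]
    nlinarith [norm_nonneg z]
  refine mem_kobayashiIndicatrix_iff.2 ⟨lam, hlam, fun z => φ (c * z),
    ⟨hφ.1.comp (by fun_prop) hmaps, fun z hz => hφ.2 (hmaps hz)⟩, by simpa using h0, ?_⟩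
  have h1 : HasDerivAt (fun z : ℂ => (c : ℂ) * z) (c : ℂ) 0 := by
    simpa using (hasDerivAt_id (0 : ℂ)).const_mul (c : ℂ)
  have h2 := HasDerivAt.scomp_of_eq (0 : ℂ) hd h1 (by simp)
  have h3 : (c : ℂ) • lam • X = lam • c • X := by
    rw [smul_comm lam c X]; exact Complex.coe_smul c _
  rwa [h3] at h2

theorem starConvex_kobayashiIndicatrix (Ω : Set (Fin d → ℂ)) (p : Fin d → ℂ) :
    StarConvex ℝ 0 (kobayashiIndicatrix Ω p) := fun X hX a b ha hb hab => by
  rw [smul_zero, zero_add]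
  exact smul_mem_kobayashiIndicatrix hX hb (by linarith)

theorem isOpen_kobayashiIndicatrix (hΩ : IsOpen Ω) (p : Fin d → ℂ) :
    IsOpen (kobayashiIndicatrix Ω p) := by
  rw [Metric.isOpen_iff]
  intro X hX
  obtain ⟨lam, hlam, φ, hφ, h0, hd⟩ := mem_kobayashiIndicatrix_iff.1 hX
  have hlam0 : 0 < lam := by linarith
  obtain ⟨r, hr1, hr⟩ := exists_between (inv_lt_one_of_one_lt₀ hlam)
  have hr0 : 0 < r := (inv_pos.2 hlam0).trans hr1
  have hrlam : 1 < r * lam := by rwa [inv_lt_iff_one_lt_mul₀ hlam0] at hr1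
  have hcomp : IsCompact (φ '' closedBall 0 r) :=
    (isCompact_closedBall 0 r).image_of_continuousOn
      (hφ.1.continuousOn.mono (closedBall_subset_ball hr))
  have hKsub : φ '' closedBall 0 r ⊆ Ω := by
    rintro _ ⟨z, hz, rfl⟩
    exact hφ.2 (closedBall_subset_ball hr hz)
  obtain ⟨ε, hε, hthick⟩ := hcomp.exists_thickening_subset_open hΩ hKsub
  -- Shrinking the disc to radius `r` with `r * lam > 1` makes its image relatively compact in `Ω`,
  -- which leaves room for a linear term that turns the derivative to `X'`.
  refine ⟨ε / (r * lam), by positivity, fun X' hX' => ?_⟩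
  have hsmall : ‖(r * lam) • (X' - X)‖ < ε := by
    rw [norm_smul, Real.norm_of_nonneg (by positivity)]
    rw [mem_ball, dist_eq_norm, lt_div_iff₀ (by positivity)] at hX'
    linarith
  have hmem : ∀ z ∈ ball (0 : ℂ) 1, (r : ℂ) * z ∈ closedBall (0 : ℂ) r := fun z hz => by
    rw [mem_ball_zero_iff] at hz
    rw [mem_closedBall_zero_iff, norm_mul, Complex.norm_real, Real.norm_of_nonneg hr0.le]
    nlinarith
  refine mem_kobayashiIndicatrix_iff.2 ⟨r * lam, hrlam,
    fun z => φ (r * z) + z • ((r * lam) • (X' - X)), ⟨?_, ?_⟩, by simpa using h0, ?_⟩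
  · refine (hφ.1.comp (by fun_prop) fun z hz => closedBall_subset_ball hr (hmem z hz)).add ?_
    fun_prop
  · intro z hz
    refine hthick (mem_thickening_iff.2 ⟨φ (r * z), ⟨_, hmem z hz, rfl⟩, ?_⟩)
    rw [dist_eq_norm, add_sub_cancel_left, norm_smul]
    rw [mem_ball_zero_iff] at hz
    nlinarith [norm_nonneg ((r * lam) • (X' - X)), norm_nonneg z]
  · have h1 : HasDerivAt (fun z : ℂ => (r : ℂ) * z) (r : ℂ) 0 := by
      simpa using (hasDerivAt_id (0 : ℂ)).const_mul (r : ℂ)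
    have h2 := HasDerivAt.scomp_of_eq (0 : ℂ) hd h1 (by simp)
    have h3 := (hasDerivAt_id (0 : ℂ)).smul_const ((r * lam) • (X' - X))
    have h4 := h2.add h3
    have h5 : (r : ℂ) • lam • X + (1 : ℂ) • (r * lam) • (X' - X) = (r * lam) • X' := by
      rw [one_smul, Complex.coe_smul r, smul_smul, ← smul_add, add_sub_cancel]
    rw [h5] at h4
    exact h4

/-! ### The Sibony metric is at most the Kobayashi-Royden metric -/

theorem SibonyAdmissible.eventually_nonneg {u : (Fin d → ℂ) → ℝ} (hΩ : IsOpen Ω) (hp : p ∈ Ω)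
    (hu : SibonyAdmissible Ω p u) : ∀ᶠ z in 𝓝 p, 0 ≤ u z :=
  (hΩ.mem_nhds hp |> fun h => mem_of_superset h hu.nonneg)

theorem SibonyAdmissible.leviBilin_nonneg {u : (Fin d → ℂ) → ℝ} (hΩ : IsOpen Ω) (hp : p ∈ Ω)
    (hu : SibonyAdmissible Ω p u) (X : Fin d → ℂ) : 0 ≤ leviBilin u p X X := by
  have := fderiv_fderiv_nonneg hu.contDiffAt hu.apply_eq_zero (hu.eventually_nonneg hΩ hp)
  rw [leviBilin_apply]
  have h1 := this X
  have h2 := this (Complex.I • X)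
  positivity

theorem leviBilin_symm {u : (Fin d → ℂ) → ℝ} (hu : ContDiffAt ℝ 2 u p) :
    LinearMap.IsSymm (leviBilin u p) := ⟨fun X Y => by
  have := isSymmSndFDerivAt_of_contDiffAt_two hu
  simp only [leviBilin_apply, RingHom.id_apply]
  rw [this X Y, this (Complex.I • X) (Complex.I • Y)]⟩

/-- The Schwarz lemma gives `u(φ(z)) ≤ |z|²`. Approaching 0 along the real and the imaginary axis
bounds the second derivative at `Y` and at `iY` by 2, and the Levi form is a quarter of their sum.
-/
theorem SibonyAdmissible.leviBilin_le_one {u : (Fin d → ℂ) → ℝ} (hΩ : IsOpen Ω) (hp : p ∈ Ω)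
    (hu : SibonyAdmissible Ω p u) {φ : ℂ → Fin d → ℂ} (hφ : IsHolDisc Ω φ) (h0 : φ 0 = p)
    {Y : Fin d → ℂ} (hd : HasDerivAt φ Y 0) : leviBilin u p Y Y ≤ 1 := by
  have hpos := hu.eventually_nonneg hΩ hp
  obtain ⟨K, hK⟩ : ∃ K, ∀ᶠ z in 𝓝 (0 : ℂ), u (φ z) ≤ K * ‖z‖ ^ 2 := by
    have h1 := isBigO_norm_sq_of_contDiffAt_two hu.contDiffAt hu.apply_eq_zero hpos
    have ht : Tendsto (fun z => φ z - p) (𝓝 0) (𝓝 0) := by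
      simpa [h0] using hd.continuousAt.tendsto.sub_const p
    have h2 := h1.comp_tendsto ht
    have h3 : (fun z => ‖φ z - p‖ ^ 2) =O[𝓝 0] fun z : ℂ => ‖z‖ ^ 2 := by
      have := hd.isBigO_sub
      simp only [h0, sub_zero] at this
      exact this.norm_norm.pow 2
    obtain ⟨K, hK⟩ := (h2.trans h3).bound
    refine ⟨K, hK.mono fun z hz => ?_⟩
    simp only [Function.comp_apply, add_sub_cancel, norm_pow, norm_norm] at hz
    exact (le_abs_self _).trans hz
  have hschwarz : ∀ z : ℂ, ‖z‖ < 1 → u (φ z) ≤ ‖z‖ ^ 2 := fun z hz =>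
    le_norm_sq_of_log_subharmonicOn (v := fun z => u (φ z))
      (fun z hz => hu.le_one _ (hφ.2 hz)) (hu.log_psh.2 φ hφ) hK hz
  have hdir : ∀ ω : ℂ, ‖ω‖ = 1 → fderiv ℝ (fderiv ℝ u) p (ω • Y) (ω • Y) / 2 ≤ 1 := by
    intro ω hω
    have h1 : HasDerivAt (fun t : ℝ => (t : ℂ) * ω) ω 0 := by
      simpa using (Complex.ofRealCLM.hasDerivAt (x := (0 : ℝ))).mul_const ω
    have h2 := HasDerivAt.scomp_of_eq (0 : ℝ) hd h1 (by simp)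
    refine le_of_tendsto (tendsto_taylor_two hu.contDiffAt hu.apply_eq_zero hpos h2 (by simp [h0])) ?_
    have hev : ∀ᶠ t : ℝ in 𝓝[≠] 0, t ∈ ball (0 : ℝ) 1 :=
      nhdsWithin_le_nhds (ball_mem_nhds 0 one_pos)
    filter_upwards [hev, self_mem_nhdsWithin] with t ht ht0
    have hn : ‖(t : ℂ) * ω‖ = |t| := by rw [norm_mul, hω, mul_one, Complex.norm_real, Real.norm_eq_abs]
    have := hschwarz ((t : ℂ) * ω) (by rw [hn]; simpa using ht)
    rw [hn, sq_abs] at this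
    exact div_le_one_of_le₀ this (sq_nonneg t)
  have h1 := hdir 1 norm_one
  have h2 := hdir Complex.I Complex.norm_I
  rw [one_smul] at h1
  rw [leviBilin_apply]
  linarith

theorem SibonyAdmissible.sqrt_leviForm_le_kobayashi {u : (Fin d → ℂ) → ℝ} (hΩ : IsOpen Ω)
    (hp : p ∈ Ω) (hu : SibonyAdmissible Ω p u) (X : Fin d → ℂ) :
    ENNReal.ofReal (Real.sqrt (leviForm u p X)) ≤ kobayashi Ω p X := by
  refine le_iInf fun lam => le_iInf fun hlam => le_iInf fun ⟨φ, hφ, h0, hd⟩ => ?_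
  refine ENNReal.ofReal_le_ofReal (Real.sqrt_le_iff.2 ⟨by positivity, ?_⟩)
  have := hu.leviBilin_le_one hΩ hp hφ h0 hφ.hasDerivAt_zero
  rw [hd, map_smul, map_smul, LinearMap.smul_apply, smul_eq_mul, smul_eq_mul] at this
  rw [leviForm_eq hu.contDiffAt, inv_pow, ← one_div, le_div_iff₀ (by positivity)]
  linarith

theorem SibonyAdmissible.sqrt_leviForm_add_le {u : (Fin d → ℂ) → ℝ} (hΩ : IsOpen Ω)
    (hp : p ∈ Ω) (hu : SibonyAdmissible Ω p u) (X Y : Fin d → ℂ) :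
    Real.sqrt (leviForm u p (X + Y)) ≤
      Real.sqrt (leviForm u p X) + Real.sqrt (leviForm u p Y) := by
  have hX := hu.leviBilin_nonneg hΩ hp X
  have hY := hu.leviBilin_nonneg hΩ hp Y
  have hsymm := leviBilin_symm hu.contDiffAt
  have hcs := LinearMap.BilinForm.apply_sq_le_of_symm (leviBilin u p)
    (hu.leviBilin_nonneg hΩ hp) hsymm X Y
  simp only [leviForm_eq hu.contDiffAt]
  rw [Real.sqrt_le_iff]
  refine ⟨by positivity, ?_⟩
  have h1 : leviBilin u p X Y ≤ Real.sqrt (leviBilin u p X X) * Real.sqrt (leviBilin u p Y Y) := by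
    rw [← Real.sqrt_mul hX]
    exact Real.le_sqrt_of_sq_le hcs
  have h2 : leviBilin u p Y X = leviBilin u p X Y := hsymm.eq Y X
  simp only [map_add, LinearMap.add_apply]
  nlinarith [Real.sq_sqrt hX, Real.sq_sqrt hY]

theorem sibony_le_kobayashiSum_two (hΩ : IsOpen Ω) (hp : p ∈ Ω) (X : Fin d → ℂ) :
    sibony Ω p X ≤ kobayashiSum 2 Ω p X := by
  refine iSup_le fun u => iSup_le fun hu => le_iInf fun Y => le_iInf fun hY => ?_
  rw [Fin.sum_univ_two] at hY ⊢
  rw [← hY]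
  calc ENNReal.ofReal (Real.sqrt (leviForm u p (Y 0 + Y 1)))
      ≤ ENNReal.ofReal (Real.sqrt (leviForm u p (Y 0)) + Real.sqrt (leviForm u p (Y 1))) :=
        ENNReal.ofReal_le_ofReal (hu.sqrt_leviForm_add_le hΩ hp _ _)
    _ ≤ _ := ENNReal.ofReal_add_le
    _ ≤ _ := add_le_add (hu.sqrt_leviForm_le_kobayashi hΩ hp _)
        (hu.sqrt_leviForm_le_kobayashi hΩ hp _)

/-! ### The identity theorem and the envelope of holomorphy -/

/-- The set of points near which `h` vanishes is open, and it is relatively closed by the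
one-variable identity theorem on complex lines inside a ball. -/
theorem eqOn_zero_of_differentiableOn_of_eventuallyEq {E : Type*} [NormedAddCommGroup E]
    [NormedSpace ℂ E] {V : Set E} (hV : IsOpen V) (hVc : IsPreconnected V) {h : E → ℂ}
    (hd : DifferentiableOn ℂ h V) {z₀ : E} (hz₀ : z₀ ∈ V) (h0 : h =ᶠ[𝓝 z₀] 0) :
    EqOn h 0 V := by
  set U : Set E := {x | h =ᶠ[𝓝 x] 0} with hU
  have hsub : V ⊆ U := by
    refine hVc.subset_of_closure_inter_subset isOpen_setOfPred_eventually_nhds ⟨z₀, hz₀, h0⟩ ?_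
    rintro x ⟨hxU, hxV⟩
    obtain ⟨r, hr, hball⟩ := Metric.isOpen_iff.1 hV x hxV
    obtain ⟨w, hwU, hwx⟩ := Metric.mem_closure_iff.1 hxU r hr
    have hw : w ∈ ball x r := by rwa [mem_ball, dist_comm]
    filter_upwards [ball_mem_nhds x hr] with y hy
    set l : ℂ → E := fun c => w + c • (y - w) with hl
    have hlc : Continuous l := by fun_prop
    have hopen : IsOpen (l ⁻¹' ball x r) := isOpen_ball.preimage hlc
    have hconv : Convex ℝ (l ⁻¹' ball x r) := by
      let : NormedSpace ℝ E := NormedSpace.restrictScalars ℝ ℂ E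
      intro a ha b hb s t hs ht hst
      have : l (s • a + t • b) = s • l a + t • l b := by
        have hst' : (s : ℂ) + t = 1 := by exact_mod_cast hst
        calc w + ((s : ℂ) * a + (t : ℂ) * b) • (y - w)
            = ((s : ℂ) + t) • w + ((s : ℂ) * a + (t : ℂ) * b) • (y - w) := by
              rw [hst', one_smul]
          _ = (s : ℂ) • (w + a • (y - w)) + (t : ℂ) • (w + b • (y - w)) := by module
      rw [mem_preimage, this]
      exact (convex_ball x r) ha hb hs ht hst
    have hdiff : DifferentiableOn ℂ (h ∘ l) (l ⁻¹' ball x r) :=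
      (hd.mono hball).comp (by fun_prop) fun c hc => hc
    have hl0 : l 0 = w := by simp [hl]
    have hl1 : l 1 = y := by simp [hl]
    have hzero := (hdiff.analyticOnNhd hopen).eqOn_zero_of_preconnected_of_eventuallyEq_zero
      hconv.isPreconnected (z₀ := 0) (by simpa [hl0] using hw)
      ((hlc.tendsto' 0 w hl0).eventually hwU)
    have := hzero (show (1 : ℂ) ∈ l ⁻¹' ball x r by simpa [hl1] using hy)
    simpa [hl1] using this
  exact fun x hx => (hsub hx).self_of_nhds

/-- If the Levi form `L` had `L(X, X) ≥ 1`, then by Cauchy–Schwarz the hyperplane `L(Y, X) = L(X,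
X)` would miss the indicatrix. The function `1 / (L(Y, X) - L(X, X))` is holomorphic there but
cannot extend to the point `X` of that hyperplane. -/
theorem SibonyAdmissible.leviBilin_lt_one_of_mem_envelope {u : (Fin d → ℂ) → ℝ} (hΩ : IsOpen Ω)
    (hp : p ∈ Ω) (hu : SibonyAdmissible Ω p u) {X : Fin d → ℂ}
    (hX : X ∈ envelopeOfHolomorphy (kobayashiIndicatrix Ω p)) : leviBilin u p X X < 1 := by
  obtain ⟨V, ⟨hVo, hVc, hIV, hext⟩, hXV⟩ := hX
  by_contra! hge
  have hIo := isOpen_kobayashiIndicatrix hΩ p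
  have hlt : ∀ Y ∈ kobayashiIndicatrix Ω p, leviBilin u p Y Y < 1 := by
    intro Y hY
    obtain ⟨lam, hlam, φ, hφ, h0, hd⟩ := mem_kobayashiIndicatrix_iff.1 hY
    have := hu.leviBilin_le_one hΩ hp hφ h0 hd
    rw [map_smul, map_smul, LinearMap.smul_apply, smul_eq_mul, smul_eq_mul] at this
    have hnn := hu.leviBilin_nonneg hΩ hp Y
    nlinarith [mul_nonneg (mul_nonneg (sub_nonneg.2 hlam.le) hnn) (by linarith : 0 ≤ lam),
      mul_nonneg (sub_nonneg.2 hlam.le) hnn]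
  set ℓ : (Fin d → ℂ) →L[ℂ] ℂ := LinearMap.toContinuousLinearMap (leviLinear u p X) with hℓ
  have hℓre : ∀ Y, (ℓ Y).re = leviBilin u p Y X := fun Y => leviSesq_re u p Y X
  have hne : ∀ Y ∈ kobayashiIndicatrix Ω p, ℓ Y - ℓ X ≠ 0 := by
    intro Y hY heq
    have h1 : leviBilin u p Y X = leviBilin u p X X := by
      rw [← hℓre, ← hℓre, sub_eq_zero.1 heq]
    have hcs := LinearMap.BilinForm.apply_sq_le_of_symm (leviBilin u p)
      (hu.leviBilin_nonneg hΩ hp) (leviBilin_symm hu.contDiffAt) Y X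
    rw [h1] at hcs
    nlinarith [hlt Y hY]
  obtain ⟨g, hg, hgeq⟩ := hext (fun Y => (ℓ Y - ℓ X)⁻¹)
    (DifferentiableOn.inv (by fun_prop) hne)
  have h0V : (0 : Fin d → ℂ) ∈ kobayashiIndicatrix Ω p := zero_mem_kobayashiIndicatrix hp
  -- The relation `g(Y) (ℓ Y - ℓ X) = 1` propagates from the indicatrix to all of `V`; at `Y = X` it
  -- reads `0 = 1`.
  have hzero := eqOn_zero_of_differentiableOn_of_eventuallyEq hVo hVc.isPreconnected
    (h := fun Y => g Y * (ℓ Y - ℓ X) - 1)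
    ((hg.mul (by fun_prop)).sub (differentiableOn_const _)) (hIV h0V) (by
      filter_upwards [hIo.mem_nhds h0V] with Y hY
      rw [hgeq hY]
      simp [inv_mul_cancel₀ (hne Y hY)])
  have := hzero hXV
  simp at this

theorem sibony_le_kobayashiTilde (hΩ : IsOpen Ω) (hp : p ∈ Ω) (X : Fin d → ℂ) :
    sibony Ω p X ≤ kobayashiTilde Ω p X := by
  refine iSup_le fun u => iSup_le fun hu => le_iInf fun t => le_iInf fun ht => le_iInf fun hX => ?_
  refine ENNReal.ofReal_le_ofReal (Real.sqrt_le_iff.2 ⟨ht.le, ?_⟩)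
  have := hu.leviBilin_lt_one_of_mem_envelope hΩ hp hX
  rw [map_smul, map_smul, LinearMap.smul_apply, smul_eq_mul, smul_eq_mul] at this
  rw [leviForm_eq hu.contDiffAt]
  have h2 : leviBilin u p X X = t ^ 2 * (t⁻¹ * (t⁻¹ * leviBilin u p X X)) := by field_simp
  rw [h2]
  nlinarith [pow_pos ht 2]

end General

/-! ### Holomorphic functions of several variables and Cauchy integrals -/

section Several

variable {E : Type*} [NormedAddCommGroup E] [NormedSpace ℂ E]

/-- Cauchy's estimate on each complex line through `a`. The factor 2 comes from using a circle of
half the available radius. -/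
theorem norm_fderiv_le_of_forall_mem_ball {f : E → ℂ} {a : E} {R M : ℝ} (hR : 0 < R)
    (hf : DifferentiableOn ℂ f (ball a R)) (hM : ∀ z ∈ ball a R, ‖f z‖ ≤ M) :
    ‖fderiv ℂ f a‖ ≤ 2 * M / R := by
  have hM0 : 0 ≤ M := (norm_nonneg _).trans (hM a (mem_ball_self hR))
  refine ContinuousLinearMap.opNorm_le_bound _ (by positivity) fun v => ?_
  rcases eq_or_ne v 0 with rfl | hv
  · simp
  have hvpos : 0 < ‖v‖ := norm_pos_iff.2 hv
  set r : ℝ := R / (2 * ‖v‖) with hr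
  have hr0 : 0 < r := by positivity
  have hmaps : ∀ c ∈ closedBall (0 : ℂ) r, a + c • v ∈ ball a R := by
    intro c hc
    rw [mem_closedBall_zero_iff] at hc
    rw [mem_ball, dist_eq_norm, add_sub_cancel_left, norm_smul]
    calc ‖c‖ * ‖v‖ ≤ r * ‖v‖ := by gcongr
      _ = R / 2 := by rw [hr]; field_simp
      _ < R := by linarith
  have hd : DifferentiableOn ℂ (fun c : ℂ => f (a + c • v)) (closure (ball 0 r)) := by
    rw [closure_ball _ hr0.ne']
    exact hf.comp (by fun_prop) hmaps
  have hcauchy := Complex.norm_deriv_le_of_forall_mem_sphere_norm_le hr0 hd.diffContOnCl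
    fun c hc => hM _ (hmaps c (sphere_subset_closedBall hc))
  have hderiv : HasDerivAt (fun c : ℂ => f (a + c • v)) (fderiv ℂ f a v) 0 := by
    have h1 : HasDerivAt (fun c : ℂ => a + c • v) v 0 := by
      simpa using ((hasDerivAt_id (0 : ℂ)).smul_const v).const_add a
    have h2 := (hf.differentiableAt (isOpen_ball.mem_nhds (mem_ball_self hR))).hasFDerivAt
    exact h2.comp_hasDerivAt_of_eq (0 : ℂ) h1 (by simp)
  rw [hderiv.deriv] at hcauchy
  refine hcauchy.trans (le_of_eq ?_)
  rw [hr]; field_simp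

/-- Cauchy's estimate is used twice: first it makes `f` locally Lipschitz, then, applied to `f(z +
h) - f(z)`, it makes the derivative locally Lipschitz. This provides the bound needed to
differentiate under the integral sign. -/
theorem continuousOn_fderiv_of_differentiableOn {f : E → ℂ} {U : Set E} (hU : IsOpen U)
    (hf : DifferentiableOn ℂ f U) : ContinuousOn (fderiv ℂ f) U := by
  intro a ha
  refine ContinuousAt.continuousWithinAt ?_
  obtain ⟨R₀, hR₀, hball⟩ := Metric.eventually_nhds_iff_ball.1 ((hU.eventually_mem ha).and
    (((hf.continuousOn.continuousAt (hU.mem_nhds ha)).norm).eventually_lt_const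
      (lt_add_one ‖f a‖)))
  set M := ‖f a‖ + 1
  set R := R₀ / 4 with hR
  have hRpos : 0 < R := by positivity
  have hderiv : ∀ z ∈ ball a (3 * R), ‖fderiv ℂ f z‖ ≤ 2 * M / R := fun z hz => by
    have hsub : ball z R ⊆ ball a R₀ := ball_subset_ball' (by
      rw [mem_ball] at hz; rw [hR] at *; linarith)
    exact norm_fderiv_le_of_forall_mem_ball hRpos (hf.mono fun y hy => (hball y (hsub hy)).1)
      fun y hy => (hball y (hsub hy)).2.le
  have hdiff : ∀ z ∈ ball a (3 * R), DifferentiableAt ℂ f z := fun z hz =>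
    hf.differentiableAt (hU.mem_nhds (hball z (ball_subset_ball (by rw [hR]; linarith) hz)).1)
  have hlip : ∀ h : E, ‖h‖ < R →
      ‖fderiv ℂ f (a + h) - fderiv ℂ f a‖ ≤ 2 * (2 * M / R * ‖h‖) / R := by
    intro h hh
    have hin : ∀ z ∈ ball a R, z ∈ ball a (3 * R) ∧ z + h ∈ ball a (3 * R) := by
      intro z hz
      rw [mem_ball, dist_eq_norm] at hz
      refine ⟨by rw [mem_ball, dist_eq_norm]; linarith, ?_⟩
      rw [mem_ball, dist_eq_norm, add_sub_right_comm]
      exact (norm_add_le _ _).trans_lt (by linarith)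
    have hF : ∀ z ∈ ball a R, HasFDerivAt (fun z => f (z + h) - f z)
        (fderiv ℂ f (z + h) - fderiv ℂ f z) z := by
      intro z hz
      have h1 := (hdiff _ (hin z hz).2).hasFDerivAt
      have h2 : HasFDerivAt (fun z => z + h) (ContinuousLinearMap.id ℂ E) z :=
        (hasFDerivAt_id z).add_const h
      have h3 := h1.comp z h2
      rw [ContinuousLinearMap.comp_id] at h3
      exact h3.sub (hdiff _ (hin z hz).1).hasFDerivAt
    have hbound : ∀ z ∈ ball a R, ‖f (z + h) - f z‖ ≤ 2 * M / R * ‖h‖ := by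
      intro z hz
      have := (convex_ball a (3 * R)).norm_image_sub_le_of_norm_fderiv_le (𝕜 := ℂ) hdiff hderiv
        (hin z hz).1 (hin z hz).2
      rwa [add_sub_cancel_left] at this
    have := norm_fderiv_le_of_forall_mem_ball hRpos
      (fun z hz => (hF z hz).differentiableAt.differentiableWithinAt) hbound
    rwa [(hF a (mem_ball_self hRpos)).fderiv] at this
  rw [ContinuousAt, tendsto_iff_norm_sub_tendsto_zero]
  have hlim : Tendsto (fun z => 2 * (2 * M / R * ‖z - a‖) / R) (𝓝 a) (𝓝 0) := by
    have : Continuous fun z => 2 * (2 * M / R * ‖z - a‖) / R := by fun_prop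
    exact this.tendsto' a 0 (by simp)
  refine squeeze_zero' (Eventually.of_forall fun _ => norm_nonneg _) ?_ hlim
  filter_upwards [ball_mem_nhds a hRpos] with z hz
  rw [mem_ball, dist_eq_norm] at hz
  simpa using hlip (z - a) hz

theorem differentiableAt_circleIntegral_of_differentiableOn {O : Set (E × ℂ)} (hO : IsOpen O)
    {Ψ : E × ℂ → ℂ} (hΨ : DifferentiableOn ℂ Ψ O) {y₀ : E} {c : ℂ} {r : ℝ} (hr : 0 ≤ r)
    (hy₀ : ∀ w ∈ sphere c r, (y₀, w) ∈ O) :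
    DifferentiableAt ℂ (fun y => ∮ w in C(c, r), Ψ (y, w)) y₀ := by
  have hcont := continuousOn_fderiv_of_differentiableOn hO hΨ
  obtain ⟨M, hM⟩ : ∃ M, ∀ w ∈ sphere c r, ‖fderiv ℂ Ψ (y₀, w)‖ ≤ M := by
    have hK : ContinuousOn (fun w => fderiv ℂ Ψ (y₀, w)) (sphere c r) :=
      hcont.comp (by fun_prop) hy₀
    obtain ⟨M, hM⟩ := (isCompact_sphere c r).exists_bound_of_continuousOn hK
    exact ⟨M, hM⟩
  have hev : ∀ᶠ y in 𝓝 y₀, ∀ w ∈ sphere c r,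
      (y, w) ∈ O ∧ ‖fderiv ℂ Ψ (y, w)‖ ≤ M + 1 := by
    refine (isCompact_sphere c r).eventually_forall_of_forall_eventually fun w hw => ?_
    have h1 := (hcont.continuousAt (hO.mem_nhds (hy₀ w hw))).norm.eventually_lt_const
      ((hM w hw).trans_lt (lt_add_one M))
    filter_upwards [hO.mem_nhds (hy₀ w hw), h1] with z hz1 hz2
    exact ⟨hz1, hz2.le⟩
  have hmem : ∀ θ : ℝ, circleMap c r θ ∈ sphere c r := circleMap_mem_sphere c hr
  have hcirc : Continuous (deriv (circleMap c r)) := by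
    have : deriv (circleMap c r) = fun θ => circleMap 0 r θ * Complex.I :=
      funext fun θ => deriv_circleMap c r θ
    rw [this]
    fun_prop
  have hFcont : ∀ y, (∀ w ∈ sphere c r, (y, w) ∈ O) →
      Continuous fun θ => deriv (circleMap c r) θ • Ψ (y, circleMap c r θ) := fun y hy =>
    hcirc.smul (hΨ.continuousOn.comp_continuous (by fun_prop) fun θ => hy _ (hmem θ))
  have key : HasFDerivAt
      (fun y => ∫ θ in Ioc 0 (2 * Real.pi), deriv (circleMap c r) θ • Ψ (y, circleMap c r θ))
      _ y₀ := hasFDerivAt_integral_of_dominated_of_fderiv_le (𝕜 := ℂ)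
    (μ := volume.restrict (Ioc 0 (2 * Real.pi)))
    (F' := fun y θ => deriv (circleMap c r) θ •
      (fderiv ℂ Ψ (y, circleMap c r θ)).comp (ContinuousLinearMap.inl ℂ E ℂ))
    (bound := fun _ => r * ((M + 1) * ‖ContinuousLinearMap.inl ℂ E ℂ‖)) hev
    (hev.mono fun y hy => (hFcont y fun w hw => (hy w hw).1).aestronglyMeasurable)
    ((hFcont y₀ hy₀).integrableOn_Icc.mono_set Ioc_subset_Icc_self)
    (by
      have h1 : Continuous fun θ => fderiv ℂ Ψ (y₀, circleMap c r θ) :=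
        hcont.comp_continuous (by fun_prop) fun θ => hy₀ _ (hmem θ)
      exact (hcirc.smul (h1.clm_comp continuous_const)).aestronglyMeasurable)
    (ae_of_all _ fun θ y hy => by
      have hn : ‖deriv (circleMap c r) θ‖ = r := by
        rw [deriv_circleMap]; simp [abs_of_nonneg hr]
      rw [norm_smul, hn]
      gcongr
      refine (ContinuousLinearMap.opNorm_comp_le _ _).trans ?_
      gcongr
      exact (hy _ (hmem θ)).2)
    (integrable_const _)
    (ae_of_all _ fun θ y hy => by
      have h1 := (hΨ.differentiableAt (hO.mem_nhds (hy _ (hmem θ)).1)).hasFDerivAt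
      have h2 := h1.comp y (hasFDerivAt_prodMk_left (𝕜 := ℂ) y (circleMap c r θ))
      exact h2.const_smul (deriv (circleMap c r) θ))
  simp only [circleIntegral, intervalIntegral.integral_of_le Real.two_pi_pos.le]
  exact key.differentiableAt

end Several

/-! ### Extension from a Hartogs figure -/

theorem vec_eta (y : Fin 2 → ℂ) : ![y 0, y 1] = y := by
  ext i; fin_cases i <;> rfl

theorem differentiable_vecCons {E : Type*} [NormedAddCommGroup E] [NormedSpace ℂ E] {f g : E → ℂ}
    (hf : Differentiable ℂ f) (hg : Differentiable ℂ g) :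
    Differentiable ℂ fun z => (![f z, g z] : Fin 2 → ℂ) :=
  differentiable_pi.2 (Fin.forall_fin_two.2 ⟨hf, hg⟩)

/-- A star-shaped domain that contains the boundary part `|y₀| < s, |y₁| = r` of a bidisc and a
neighbourhood of `{0} × {|y₁| ≤ r}` has an envelope of holomorphy that contains the bidisc. -/
theorem bidisc_subset_envelopeOfHolomorphy {I : Set (Fin 2 → ℂ)} (hI : IsOpen I)
    (hstar : StarConvex ℝ 0 I) {s r ε : ℝ} (hs : 0 < s) (hr : 0 < r) (hε : 0 < ε)
    (hshell : ∀ y : Fin 2 → ℂ, ‖y 0‖ < s → ‖y 1‖ = r → y ∈ I)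
    (hslice : ∀ y : Fin 2 → ℂ, ‖y 0‖ < ε → ‖y 1‖ ≤ r → y ∈ I) :
    {y : Fin 2 → ℂ | ‖y 0‖ < s ∧ ‖y 1‖ < r} ⊆ envelopeOfHolomorphy I := by
  set P : Set (Fin 2 → ℂ) := {y | ‖y 0‖ < s ∧ ‖y 1‖ < r} with hP
  have hPo : IsOpen P := (isOpen_lt (by fun_prop) continuous_const).and
    (isOpen_lt (by fun_prop) continuous_const)
  have hPstar : StarConvex ℝ 0 P := by
    intro y hy a b ha hb hab
    rw [smul_zero, zero_add]
    have hb1 : b ≤ 1 := by linarith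
    have : ∀ i, ‖(b • y) i‖ ≤ ‖y i‖ := fun i => by
      rw [Pi.smul_apply, norm_smul, Real.norm_of_nonneg hb]
      exact mul_le_of_le_one_left (norm_nonneg _) hb1
    exact ⟨(this 0).trans_lt hy.1, (this 1).trans_lt hy.2⟩
  have h0I : (0 : Fin 2 → ℂ) ∈ I := hslice 0 (by simpa) (by simpa using hr.le)
  have h0P : (0 : Fin 2 → ℂ) ∈ P := ⟨by simpa, by simpa⟩
  have hsub : P ⊆ I ∪ P := subset_union_right
  -- Both sets are star-shaped about 0, so the union is connected, and so is the intersection, which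
  -- makes the extension to `I ∪ P` single-valued.
  refine subset_sUnion_of_subset _ (I ∪ P) hsub ⟨hI.union hPo, ?_, subset_union_left, ?_⟩
  · exact ⟨⟨0, Or.inl h0I⟩, (StarConvex.isPathConnected (hstar.union hPstar) (Or.inl h0I)).isConnected.isPreconnected⟩
  intro f hf
  -- The Cauchy integral in the second variable only sees `f` on the shell, so it is defined on the
  -- whole bidisc. The slice condition identifies it with `f` near 0.
  set G : (Fin 2 → ℂ) → ℂ := fun y =>
    (2 * Real.pi * Complex.I)⁻¹ • ∮ w in C(0, r), (w - y 1)⁻¹ • f ![y 0, w] with hG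
  have hGd : DifferentiableOn ℂ G P := by
    intro y hy
    refine DifferentiableAt.differentiableWithinAt (DifferentiableAt.fun_const_smul ?_ _)
    set l : (Fin 2 → ℂ) × ℂ → (Fin 2 → ℂ) := fun q => ![q.1 0, q.2] with hl
    have hld : Differentiable ℂ l := differentiable_vecCons (by fun_prop) (by fun_prop)
    set O : Set ((Fin 2 → ℂ) × ℂ) := l ⁻¹' I ∩ {q | q.2 - q.1 1 ≠ 0} with hO
    have hOo : IsOpen O := (hI.preimage hld.continuous).inter
      (isOpen_ne_fun (by fun_prop) continuous_const)
    refine differentiableAt_circleIntegral_of_differentiableOn (O := O)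
      (Ψ := fun q => (q.2 - q.1 1)⁻¹ • f (l q)) hOo ?_ hr.le ?_
    · refine DifferentiableOn.smul (DifferentiableOn.fun_inv (h := fun q : (Fin 2 → ℂ) × ℂ => q.2 - q.1 1)
        (by fun_prop) fun q hq => hq.2) ?_
      exact hf.comp hld.differentiableOn fun q hq => hq.1
    · intro w hw
      rw [mem_sphere_zero_iff_norm] at hw
      refine ⟨hshell _ hy.1 hw, fun h => ?_⟩
      have : w = y 1 := sub_eq_zero.1 h
      exact absurd hy.2 (by rw [← this, hw]; exact lt_irrefl _)
  have hGf : EqOn G f (I ∩ P) := by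
    have hcauchy : ∀ y : Fin 2 → ℂ, ‖y 0‖ < ε → ‖y 1‖ < r → G y = f y := by
      intro y hy0 hy1
      have hd : DifferentiableOn ℂ (fun w => f ![y 0, w]) (closure (ball 0 r)) := by
        rw [closure_ball _ hr.ne']
        refine hf.comp (differentiable_vecCons (by fun_prop) (by fun_prop)).differentiableOn ?_
        intro w hw
        exact hslice _ hy0 (by simpa using hw)
      have := hd.diffContOnCl.circleIntegral_sub_inv_smul (w := y 1) (by simpa using hy1)
      rw [hG]
      beta_reduce
      rw [this, vec_eta, inv_smul_smul₀ Complex.two_pi_I_ne_zero]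
    have := eqOn_zero_of_differentiableOn_of_eventuallyEq (h := fun y => G y - f y)
      (hI.inter hPo) ((StarConvex.isPathConnected (hstar.inter hPstar) ⟨h0I, h0P⟩).isConnected.isPreconnected)
      ((hGd.mono inter_subset_right).sub (hf.mono inter_subset_left)) (z₀ := 0) ⟨h0I, h0P⟩ (by
        have h1 : ∀ᶠ y : Fin 2 → ℂ in 𝓝 0, ‖y 0‖ < ε :=
          (isOpen_lt (by fun_prop) (by fun_prop)).mem_nhds (by simpa)
        have h2 : ∀ᶠ y : Fin 2 → ℂ in 𝓝 0, ‖y 1‖ < r :=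
          (isOpen_lt (by fun_prop) (by fun_prop)).mem_nhds (by simpa)
        filter_upwards [h1, h2] with y hy1 hy2
        simp [hcauchy y hy1 hy2])
    exact fun y hy => sub_eq_zero.1 (this hy)
  classical
  refine ⟨P.piecewise G f, ?_, ?_⟩
  · have hPeq : EqOn (P.piecewise G f) G P := piecewise_eqOn P G f
    have hIeq : EqOn (P.piecewise G f) f I := fun y hy => by
      by_cases hyP : y ∈ P
      · rw [hPeq hyP, hGf ⟨hy, hyP⟩]
      · exact piecewise_eq_of_notMem _ _ _ hyP
    rintro y (hy | hy)
    · exact ((hf.differentiableAt (hI.mem_nhds hy)).congr_of_eventuallyEq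
        (hIeq.eventuallyEq_of_mem (hI.mem_nhds hy))).differentiableWithinAt
    · exact ((hGd.differentiableAt (hPo.mem_nhds hy)).congr_of_eventuallyEq
        (hPeq.eventuallyEq_of_mem (hPo.mem_nhds hy))).differentiableWithinAt
  · intro y hy
    by_cases hyP : y ∈ P
    · rw [piecewise_eq_of_mem _ _ _ hyP, hGf ⟨hy, hyP⟩]
    · exact piecewise_eq_of_notMem _ _ _ hyP

/-! ### The model domains -/

/-- Monotonicity of `ψ(t)/t` with denominators cleared; continuity extends it to the endpoint `s =
1`. -/
theorem profile_mul_le {ψ : ℝ → ℝ} (hψ_cont : ContinuousOn ψ (Icc 0 1))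
    (hψ_incr : MonotoneOn (fun x => ψ x / x) (Ioo 0 1)) {r s : ℝ} (hr : 0 < r) (hrs : r ≤ s)
    (hs : s ≤ 1) : ψ r * s ≤ ψ s * r := by
  rcases hrs.eq_or_lt with rfl | hlt
  · exact le_rfl
  have hbelow : ∀ t, r ≤ t → t < 1 → ψ r * t ≤ ψ t * r := fun t hrt ht => by
    have h0t : 0 < t := hr.trans_le hrt
    have := hψ_incr ⟨hr, hrt.trans_lt ht⟩ ⟨h0t, ht⟩ hrt
    exact (div_le_div_iff₀ hr h0t).1 this
  rcases hs.eq_or_lt with rfl | hs1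
  · have hc : ContinuousWithinAt ψ (Iio 1) 1 :=
      ((hψ_cont 1 (by simp)).mono_of_mem_nhdsWithin (Icc_mem_nhdsLT zero_lt_one))
    have hid : Tendsto (fun t : ℝ => ψ r * t) (𝓝[<] 1) (𝓝 (ψ r * 1)) :=
      (tendsto_id.const_mul (ψ r)).mono_left nhdsWithin_le_nhds
    refine le_of_tendsto_of_tendsto hid (hc.tendsto.mul_const r) ?_
    filter_upwards [Ioo_mem_nhdsLT hlt] with t ht
    exact hbelow t ht.1.le ht.2
  · exact hbelow s hrs hs1

theorem profileInv_spec {ψ : ℝ → ℝ} (hψ_cont : ContinuousOn ψ (Icc 0 1)) (hψ_zero : ψ 0 = 0)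
    {δ : ℝ} (hδ : 0 < δ) (hδψ : δ ≤ ψ 1) :
    0 < profileInv ψ δ ∧ profileInv ψ δ ≤ 1 ∧ ψ (profileInv ψ δ) = δ := by
  have hex : ∃ x ∈ Icc (0 : ℝ) 1, ψ x = δ := by
    have := intermediate_value_Icc zero_le_one hψ_cont
    exact this ⟨by rw [hψ_zero]; exact hδ.le, hδψ⟩
  have hmem : profileInv ψ δ ∈ Icc (0 : ℝ) 1 := Function.invFunOn_mem hex
  have heq : ψ (profileInv ψ δ) = δ := Function.invFunOn_eq hex
  refine ⟨lt_of_le_of_ne hmem.1 fun h => ?_, hmem.2, heq⟩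
  rw [← h, hψ_zero] at heq
  exact hδ.ne heq

theorem isOpen_modelDomain {ψ : ℝ → ℝ} (hψ_cont : ContinuousOn ψ (Icc 0 1)) :
    IsOpen (modelDomain ψ) := by
  have h1 : IsOpen {z : Fin 2 → ℂ | ‖z 1‖ < 1} := isOpen_lt (by fun_prop) continuous_const
  have hc : ContinuousOn (fun z : Fin 2 → ℂ => ψ ‖z 1‖ - (z 0).re) {z | ‖z 1‖ < 1} := by
    refine ContinuousOn.sub (hψ_cont.comp (by fun_prop) fun z hz => ⟨norm_nonneg _, ?_⟩)
      (Continuous.continuousOn (by fun_prop))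
    have hz' : ‖z 1‖ < 1 := hz
    exact hz'.le
  have h2 := hc.isOpen_inter_preimage h1 (isOpen_Ioi (a := (0 : ℝ)))
  have h0 : IsOpen {z : Fin 2 → ℂ | ‖z 0‖ < 1} := isOpen_lt (by fun_prop) continuous_const
  convert h0.inter h2 using 1
  ext z
  simp [modelDomain]

theorem basePoint_mem_modelDomain {ψ : ℝ → ℝ} (hψ_zero : ψ 0 = 0) {δ : ℝ} (hδ : 0 < δ)
    (hδ1 : δ < 1) : basePoint δ ∈ modelDomain ψ := by
  refine ⟨?_, ?_, ?_⟩
  · simpa [basePoint, abs_of_pos hδ] using hδ1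
  · simp [basePoint]
  · simpa [basePoint, hψ_zero] using hδ

/-! ### Upper estimates -/

section Upper

variable {ψ : ℝ → ℝ} (hψ_cont : ContinuousOn ψ (Icc 0 1))
  (hψ_nonneg : ∀ x ∈ Icc (0 : ℝ) 1, 0 ≤ ψ x) (hψ_zero : ψ 0 = 0)
  (hψ_incr : MonotoneOn (fun x => ψ x / x) (Ioo 0 1))
  {δ x b : ℝ} (hδ : 0 < δ) (hx : 0 < x) (hxδ : ψ x = δ) (hb : 0 < b) (hbx : b * x ≤ δ)
  (hbδ : δ + b ≤ 1)

include hψ_cont hψ_nonneg hψ_zero hψ_incr hδ hx hxδ hb hbx hbδ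

theorem kobayashi_modelDomain_le (y : Fin 2 → ℂ) (hy : ‖y 0‖ ≤ b * ‖y 1‖) :
    kobayashi (modelDomain ψ) (basePoint δ) y ≤ ENNReal.ofReal ‖y 1‖ := by
  rcases eq_or_ne (y 1) 0 with h1 | h1
  · have h0 : y 0 = 0 := by simpa [h1] using hy
    have : y = 0 := by ext i; fin_cases i <;> assumption
    rw [this, kobayashi_zero (basePoint_mem_modelDomain hψ_zero hδ (by linarith))]
    exact zero_le
  have hn : 0 < ‖y 1‖ := norm_pos_iff.2 h1
  set q : ℝ := ‖y 1‖⁻¹ with hq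
  have hqpos : 0 < q := inv_pos.2 hn
  have hq0 : ‖(q : ℂ) * y 0‖ ≤ b := by
    rw [norm_mul, Complex.norm_real, Real.norm_of_nonneg hqpos.le, hq, inv_mul_le_iff₀ hn]
    linarith
  have hq1 : ‖(q : ℂ) * y 1‖ = 1 := by
    rw [norm_mul, Complex.norm_real, Real.norm_of_nonneg hqpos.le, hq, inv_mul_cancel₀ hn.ne']
  -- After normalization `|φ₁(z)| = |z|` and `Re φ₀(z) ≤ -δ + b |z|`. For `|z| < x` this is negative
  -- since `b x ≤ δ`; for `|z| ≥ x` it is below `δ |z| / x ≤ ψ(|z|)`.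
  set φ : ℂ → Fin 2 → ℂ := fun z => ![-(δ : ℂ) + (q * y 0) * z, (q * y 1) * z] with hφ
  have hdiff : Differentiable ℂ φ := differentiable_vecCons (by fun_prop) (by fun_prop)
  have hmaps : MapsTo φ (ball 0 1) (modelDomain ψ) := by
    intro z hz
    rw [mem_ball_zero_iff] at hz
    have hz0 := norm_nonneg z
    have hle : ‖(q : ℂ) * y 0 * z‖ ≤ b * ‖z‖ := by rw [norm_mul]; gcongr
    have hnorm1 : ‖(q : ℂ) * y 1 * z‖ = ‖z‖ := by rw [norm_mul, hq1, one_mul]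
    refine ⟨?_, ?_, ?_⟩
    · change ‖-(δ : ℂ) + (q * y 0) * z‖ < 1
      refine (norm_add_le _ _).trans_lt ?_
      rw [norm_neg, Complex.norm_real, Real.norm_of_nonneg hδ.le]
      nlinarith
    · change ‖(q : ℂ) * y 1 * z‖ < 1
      rwa [hnorm1]
    · change (-(δ : ℂ) + (q * y 0) * z).re < ψ ‖(q : ℂ) * y 1 * z‖
      rw [hnorm1, Complex.add_re, Complex.neg_re, Complex.ofReal_re]
      have hre := (Complex.re_le_norm ((q : ℂ) * y 0 * z)).trans hle
      rcases lt_or_ge ‖z‖ x with hzx | hzx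
      · have := hψ_nonneg ‖z‖ ⟨hz0, hz.le⟩
        nlinarith
      · have := profile_mul_le hψ_cont hψ_incr hx hzx hz.le
        rw [hxδ] at this
        have h2 : b * ‖z‖ * x ≤ ψ ‖z‖ * x := by nlinarith
        have h3 := le_of_mul_le_mul_right h2 hx
        linarith
  have hder : HasDerivAt φ (q • y) 0 := by
    rw [hasDerivAt_pi]
    refine Fin.forall_fin_two.2 ⟨?_, ?_⟩
    · simpa [hφ] using ((hasDerivAt_id (0 : ℂ)).const_mul ((q : ℂ) * y 0)).const_add (-(δ : ℂ))
    · simpa [hφ] using (hasDerivAt_id (0 : ℂ)).const_mul ((q : ℂ) * y 1)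
  have := kobayashi_le_of_disc (p := basePoint δ) hqpos ⟨hdiff.differentiableOn, hmaps⟩
    (by simp [hφ, basePoint]) hder
  rwa [hq, inv_inv] at this

theorem kobayashiSum_modelDomain_le (xN xT : ℂ) :
    kobayashiSum 2 (modelDomain ψ) (basePoint δ) ![xN, xT] ≤
      ENNReal.ofReal (2 * ‖xN‖ / b + ‖xT‖) := by
  have hkob := kobayashi_modelDomain_le hψ_cont hψ_nonneg hψ_zero hψ_incr hδ hx hxδ hb hbx hbδ
  -- The smallest tangential component that puts a vector with normal component `xN` in the
  -- admissible cone; the second piece `(0, xT - a)` is purely tangential.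
  set a : ℝ := ‖xN‖ / b with ha
  have ha0 : 0 ≤ a := by positivity
  have hna : ‖(a : ℂ)‖ = a := by rw [Complex.norm_real, Real.norm_of_nonneg ha0]
  refine (iInf₂_le ![![xN, (a : ℂ)], ![0, xT - a]] ?_).trans ?_
  · rw [Fin.sum_univ_two]
    ext i; fin_cases i <;> simp
  rw [Fin.sum_univ_two]
  have h1 := hkob ![xN, (a : ℂ)] (by
    change ‖xN‖ ≤ b * ‖(a : ℂ)‖
    rw [hna, ha]; exact le_of_eq (by field_simp))
  have h2 := hkob ![0, xT - a] (by
    change ‖(0 : ℂ)‖ ≤ b * ‖xT - a‖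
    rw [norm_zero]; positivity)
  refine (add_le_add h1 h2).trans ?_
  change ENNReal.ofReal ‖(a : ℂ)‖ + ENNReal.ofReal ‖xT - a‖ ≤ _
  rw [← ENNReal.ofReal_add (norm_nonneg _) (norm_nonneg _)]
  refine ENNReal.ofReal_le_ofReal ?_
  have h3 := norm_sub_le xT (a : ℂ)
  have h4 : 2 * ‖xN‖ / b = a + a := by rw [ha]; ring
  rw [hna] at *
  linarith

theorem kobayashiTilde_modelDomain_le (xN xT : ℂ) :
    kobayashiTilde (modelDomain ψ) (basePoint δ) ![xN, xT] ≤
      ENNReal.ofReal (2 * ‖xN‖ / b + 2 * ‖xT‖) := by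
  have hkob := kobayashi_modelDomain_le hψ_cont hψ_nonneg hψ_zero hψ_incr hδ hx hxδ hb hbx hbδ
  set I := kobayashiIndicatrix (modelDomain ψ) (basePoint δ) with hI
  have hIo : IsOpen I := isOpen_kobayashiIndicatrix (isOpen_modelDomain hψ_cont) _
  have h0I : (0 : Fin 2 → ℂ) ∈ I := zero_mem_kobayashiIndicatrix
    (basePoint_mem_modelDomain hψ_zero hδ (by linarith))
  have hmem : ∀ y : Fin 2 → ℂ, ‖y 0‖ ≤ b * ‖y 1‖ → ‖y 1‖ ≤ 1 / 2 → y ∈ I := fun y h0 h1 =>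
    (hkob y h0).trans_lt (ENNReal.ofReal_lt_one.2 (by linarith))
  obtain ⟨η, hη, hball⟩ := Metric.isOpen_iff.1 hIo 0 h0I
  -- On the shell `|y₁| = 1/2` the cone condition is `|y₀| ≤ b/2`. The slice is covered by the ball
  -- of radius `η` when `|y₁| < η`, and by the cone when `|y₁| ≥ η`, since then `|y₀| < b η ≤ b
  -- |y₁|`.
  have henv := bidisc_subset_envelopeOfHolomorphy hIo
    (starConvex_kobayashiIndicatrix _ _) (s := b / 2) (r := 1 / 2) (ε := min η (b * η))
    (by positivity) (by norm_num) (by positivity)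
    (fun y h0 h1 => hmem y (by rw [h1]; linarith) h1.le)
    (fun y h0 h1 => by
      rcases lt_or_ge ‖y 1‖ η with h | h
      · refine hball (mem_ball_zero_iff.2 ((pi_norm_lt_iff hη).2 (Fin.forall_fin_two.2 ⟨?_, h⟩)))
        exact h0.trans_le (min_le_left _ _)
      · refine hmem y ?_ h1
        have := h0.trans_le (min_le_right _ _)
        nlinarith)
  refine ENNReal.le_of_forall_pos_le_add fun e he _ => ?_
  have he' : (0 : ℝ) < e := NNReal.coe_pos.2 he
  set t : ℝ := 2 * ‖xN‖ / b + 2 * ‖xT‖ + e with ht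
  have hN : 0 ≤ 2 * ‖xN‖ / b := by positivity
  have hT := norm_nonneg xT
  have ht0 : 0 < t := by positivity
  have htN : 2 * ‖xN‖ < t * b := by
    rw [← div_lt_iff₀ hb]; linarith
  have hin : t⁻¹ • ![xN, xT] ∈ envelopeOfHolomorphy I := by
    refine henv ⟨?_, ?_⟩
    · change ‖t⁻¹ • xN‖ < b / 2
      rw [norm_smul, norm_inv, Real.norm_of_nonneg ht0.le, inv_mul_lt_iff₀ ht0]
      linarith
    · change ‖t⁻¹ • xT‖ < 1 / 2
      rw [norm_smul, norm_inv, Real.norm_of_nonneg ht0.le, inv_mul_lt_iff₀ ht0]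
      linarith
  refine (iInf_le_of_le t (iInf_le_of_le ht0 (iInf_le _ hin))).trans (le_of_eq ?_)
  rw [ht, ENNReal.ofReal_add (by positivity) he'.le, ENNReal.ofReal_coe_nnreal]

end Upper

/-! ### The lower estimate -/

theorem coe_le_log_ofReal {x y : ℝ} :
    (y : EReal) ≤ ENNReal.log (ENNReal.ofReal x) ↔ Real.exp y ≤ x := by
  rcases le_or_gt x 0 with hx | hx
  · rw [ENNReal.log_ofReal, if_pos hx]
    simp [hx.trans_lt (Real.exp_pos y)]
  · rw [ENNReal.log_ofReal_of_pos hx, EReal.coe_le_coe_iff, Real.le_log_iff_exp_le hx]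

/-- The sub-mean value inequality at `a` for `log v`, if `v` has a minorant `|g| ^ k`, `g`
holomorphic, that touches it at `a`. -/
theorem exists_log_le_circleMean_of_rpow_le {v : ℂ → ℝ} {g : ℂ → ℂ} {a : ℂ} {k : ℝ} (hk : 0 < k)
    (hg : AnalyticAt ℂ g a) (ha : v a ≤ ‖g a‖ ^ k) (hv : ∀ᶠ z in 𝓝 a, ‖g z‖ ^ k ≤ v z) :
    ∃ ρ > 0, ∀ r, 0 < r → r < ρ → ENNReal.log (ENNReal.ofReal (v a)) ≤
      circleMean (fun z => ENNReal.log (ENNReal.ofReal (v z))) a r := by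
  rcases le_or_gt (v a) 0 with h0 | h0
  · refine ⟨1, one_pos, fun r _ _ => ?_⟩
    rw [ENNReal.log_ofReal, if_pos h0]
    exact bot_le
  have hga : g a ≠ 0 := by
    intro h
    rw [h, norm_zero, Real.zero_rpow hk.ne'] at ha
    linarith
  have hexp : ∀ z, g z ≠ 0 → Real.exp (k * Real.log ‖g z‖) = ‖g z‖ ^ k := fun z hz => by
    rw [Real.rpow_def_of_pos (norm_pos_iff.2 hz), mul_comm]
  refine exists_le_circleMean_of_log_norm_le (v := fun z => ENNReal.log (ENNReal.ofReal (v z)))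
    (k := k) hg hga ?_ ?_
  · rw [log_ofReal_le_coe, hexp a hga]
    exact ha
  · filter_upwards [hv, hg.continuousAt.eventually_ne hga] with z hz hz0
    rw [coe_le_log_ofReal, hexp z hz0]
    exact hz

/-- The sub-mean value inequality for a majorant of `log (|g| ^ 2 + |h| ^ 2)`, `g` and `h`
holomorphic, that touches it at `a`. -/
theorem exists_log_le_circleMean_of_sq_add_sq_le {v : ℂ → ℝ} {g h : ℂ → ℂ} {a : ℂ}
    (hg : AnalyticAt ℂ g a) (hh : AnalyticAt ℂ h a) (ha : v a ≤ ‖g a‖ ^ 2 + ‖h a‖ ^ 2)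
    (hv : ∀ᶠ z in 𝓝 a, ‖g z‖ ^ 2 + ‖h z‖ ^ 2 ≤ v z) :
    ∃ ρ > 0, ∀ r, 0 < r → r < ρ → ENNReal.log (ENNReal.ofReal (v a)) ≤
      circleMean (fun z => ENNReal.log (ENNReal.ofReal (v z))) a r := by
  rcases le_or_gt (v a) 0 with h0 | h0
  · refine ⟨1, one_pos, fun r _ _ => ?_⟩
    rw [ENNReal.log_ofReal, if_pos h0]
    exact bot_le
  set N : ℝ := ‖g a‖ ^ 2 + ‖h a‖ ^ 2 with hN
  have hNpos : 0 < N := h0.trans_le ha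
  set s : ℝ := Real.sqrt N with hs
  have hspos : 0 < s := Real.sqrt_pos.2 hNpos
  have hss : s ^ 2 = N := Real.sq_sqrt hNpos.le
  -- The component of `(g, h)` along the unit vector in the direction `(g(a), h(a))`: by
  -- Cauchy–Schwarz `|G|²` is at most `|g|² + |h|²`, with equality at `a`.
  set G : ℂ → ℂ := fun z =>
    ((starRingEnd ℂ) (g a) * g z + (starRingEnd ℂ) (h a) * h z) / (s : ℂ) with hG
  have hnormG : ∀ z, ‖G z‖ = ‖(starRingEnd ℂ) (g a) * g z + (starRingEnd ℂ) (h a) * h z‖ / s :=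
    fun z => by rw [hG, norm_div, Complex.norm_real, Real.norm_of_nonneg hspos.le]
  have hGan : AnalyticAt ℂ G a :=
    ((analyticAt_const.mul hg).add (analyticAt_const.mul hh)).div analyticAt_const
      (by exact_mod_cast hspos.ne')
  refine exists_log_le_circleMean_of_rpow_le (k := 2) two_pos hGan ?_ ?_
  · have h1 : (starRingEnd ℂ) (g a) * g a + (starRingEnd ℂ) (h a) * h a = (N : ℂ) := by
      rw [mul_comm, Complex.mul_conj', mul_comm ((starRingEnd ℂ) (h a)), Complex.mul_conj', hN]
      push_cast
      rfl
    rw [hnormG, h1, Complex.norm_real, Real.norm_of_nonneg hNpos.le, Real.rpow_two, div_pow, hss,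
      sq, mul_div_assoc, div_self hNpos.ne', mul_one]
    exact ha
  · filter_upwards [hv] with z hz
    refine le_trans ?_ hz
    rw [hnormG, Real.rpow_two, div_pow, hss, div_le_iff₀ hNpos]
    have h1 : ‖(starRingEnd ℂ) (g a) * g z + (starRingEnd ℂ) (h a) * h z‖ ≤
        ‖g a‖ * ‖g z‖ + ‖h a‖ * ‖h z‖ := by
      refine (norm_add_le _ _).trans (le_of_eq ?_)
      simp only [norm_mul, RCLike.norm_conj]
    calc _ ≤ (‖g a‖ * ‖g z‖ + ‖h a‖ * ‖h z‖) ^ 2 := by gcongr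
      _ ≤ _ := by
        rw [hN]
        nlinarith [sq_nonneg (‖g a‖ * ‖h z‖ - ‖h a‖ * ‖g z‖)]

/-- The first component of `innerCandidate`. -/
def innerFst (z : Fin 2 → ℂ) : ℂ := (1 / 4) * z 1

/-- The second component of `innerCandidate`. -/
def innerSnd (x δ : ℝ) (z : Fin 2 → ℂ) : ℂ := (x / 40) * ((z 0 + δ) / (z 0 - δ))

/-- The competitor near the base point. -/
def innerCandidate (x δ : ℝ) (z : Fin 2 → ℂ) : ℝ := ‖innerFst z‖ ^ 2 + ‖innerSnd x δ z‖ ^ 2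

/-- The exponent of the outer competitor. -/
def outerExponent (x : ℝ) : ℝ := 2 + (Real.log (4 / x))⁻¹

/-- The competitor away from the line `z₁ = 0`. -/
def outerCandidate (x : ℝ) (z : Fin 2 → ℂ) : ℝ := ‖z 1‖ ^ outerExponent x

/-- A competitor in the Sibony metric of the model domain at the base point. -/
def candidate (x δ : ℝ) (z : Fin 2 → ℂ) : ℝ :=
  if ‖z 1‖ < x / 2 then max (innerCandidate x δ z) (outerCandidate x z) else outerCandidate x z

section Lower

variable {ψ : ℝ → ℝ} {δ x : ℝ}

theorem log_four_div_pos (hx : 0 < x) (hx1 : x ≤ 1) : 0 < Real.log (4 / x) :=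
  Real.log_pos (by rw [lt_div_iff₀ hx]; linarith)

theorem two_lt_outerExponent (hx : 0 < x) (hx1 : x ≤ 1) : 2 < outerExponent x :=
  lt_add_of_pos_right _ (inv_pos.2 (log_four_div_pos hx hx1))

theorem outerCandidate_nonneg (x : ℝ) (z : Fin 2 → ℂ) : 0 ≤ outerCandidate x z :=
  Real.rpow_nonneg (norm_nonneg _) _

theorem outerCandidate_le_candidate (x δ : ℝ) (z : Fin 2 → ℂ) :
    outerCandidate x z ≤ candidate x δ z := by
  unfold candidate; split_ifs
  · exact le_max_right _ _
  · exact le_rfl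

theorem continuous_outerCandidate (hx : 0 < x) (hx1 : x ≤ 1) : Continuous (outerCandidate x) := by
  have : Continuous fun z : Fin 2 → ℂ => ‖z 1‖ := by fun_prop
  exact this.rpow_const fun _ => Or.inr (by linarith [two_lt_outerExponent hx hx1])

theorem innerCandidate_eq (hx : 0 < x) (z : Fin 2 → ℂ) :
    innerCandidate x δ z = ‖z 1‖ ^ 2 / 16 + x ^ 2 / 1600 * ‖(z 0 + δ) / (z 0 - δ)‖ ^ 2 := by
  have h1 : ‖innerFst z‖ = ‖z 1‖ / 4 := by
    rw [innerFst, norm_mul]; norm_num; ring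
  have h2 : ‖innerSnd x δ z‖ = x / 40 * ‖(z 0 + δ) / (z 0 - δ)‖ := by
    have : ((x : ℂ) / 40) = ((x / 40 : ℝ) : ℂ) := by push_cast; rfl
    rw [innerSnd, norm_mul, this, Complex.norm_real, Real.norm_of_nonneg (by positivity)]
  rw [innerCandidate, h1, h2]
  ring

variable (hψ_cont : ContinuousOn ψ (Icc 0 1)) (hψ_zero : ψ 0 = 0)
  (hψ_incr : MonotoneOn (fun x => ψ x / x) (Ioo 0 1))
  (hδ : 0 < δ) (hx : 0 < x) (hx1 : x ≤ 1) (hxδ : ψ x = δ)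

include hψ_cont hψ_zero hψ_incr hδ hx hx1 hxδ

theorem re_lt_of_mem_modelDomain {z : Fin 2 → ℂ} (hz : z ∈ modelDomain ψ)
    (hz1 : ‖z 1‖ < x / 2) : (z 0).re < δ / 2 := by
  refine hz.2.2.trans_le ?_
  rcases eq_or_ne (z 1) 0 with h0 | h0
  · rw [h0, norm_zero, hψ_zero]; positivity
  · have := profile_mul_le hψ_cont hψ_incr (norm_pos_iff.2 h0) (by linarith : ‖z 1‖ ≤ x) hx1
    rw [hxδ] at this
    have h2 : ψ ‖z 1‖ * x ≤ δ / 2 * x := by nlinarith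
    exact le_of_mul_le_mul_right h2 hx

theorem sub_ne_zero_of_mem_modelDomain {z : Fin 2 → ℂ} (hz : z ∈ modelDomain ψ)
    (hz1 : ‖z 1‖ < x / 2) : z 0 - δ ≠ 0 := by
  intro h
  have h1 := re_lt_of_mem_modelDomain hψ_cont hψ_zero hψ_incr hδ hx hx1 hxδ hz hz1
  rw [sub_eq_zero.1 h, Complex.ofReal_re] at h1
  linarith

theorem norm_div_le_three {z : Fin 2 → ℂ} (hz : z ∈ modelDomain ψ)
    (hz1 : ‖z 1‖ < x / 2) : ‖(z 0 + δ) / (z 0 - δ)‖ ≤ 3 := by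
  have h1 := re_lt_of_mem_modelDomain hψ_cont hψ_zero hψ_incr hδ hx hx1 hxδ hz hz1
  have h2 := sub_ne_zero_of_mem_modelDomain hψ_cont hψ_zero hψ_incr hδ hx hx1 hxδ hz hz1
  rw [norm_div, div_le_iff₀ (norm_pos_iff.2 h2)]
  refine abs_le_of_sq_le_sq' ?_ (by positivity) |>.2
  rw [mul_pow, Complex.sq_norm, Complex.sq_norm, Complex.normSq_apply, Complex.normSq_apply]
  simp only [Complex.add_re, Complex.sub_re, Complex.add_im, Complex.sub_im, Complex.ofReal_re,
    Complex.ofReal_im, add_zero, sub_zero]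
  -- For `z₀ = s + iy` this is `9 (s - δ)² - (s + δ)² = 8 (δ/2 - s) (2δ - s)`, up to a nonnegative
  -- multiple of `y²`.
  nlinarith [mul_pos (sub_pos.2 h1) (by linarith : 0 < 2 * δ - (z 0).re),
    mul_self_nonneg (z 0).im]

theorem innerCandidate_le {z : Fin 2 → ℂ} (hz : z ∈ modelDomain ψ) (hz1 : ‖z 1‖ < x / 2) :
    innerCandidate x δ z ≤ ‖z 1‖ ^ 2 / 16 + 9 * x ^ 2 / 1600 := by
  have h := norm_div_le_three hψ_cont hψ_zero hψ_incr hδ hx hx1 hxδ hz hz1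
  rw [innerCandidate_eq hx]
  have : ‖(z 0 + δ) / (z 0 - δ)‖ ^ 2 ≤ 3 ^ 2 := by gcongr
  nlinarith [mul_le_mul_of_nonneg_left this (sq_nonneg x)]

/-- Here `x ≤ 4 |z₂|`, so the inner function is at most `(1/16 + 9/100) |z₂|²`, while the outer one
is at least `|z₂|²/3`. -/
theorem innerCandidate_le_outerCandidate {z : Fin 2 → ℂ} (hz : z ∈ modelDomain ψ)
    (hz1 : ‖z 1‖ < x / 2) (hz4 : x / 4 ≤ ‖z 1‖) : innerCandidate x δ z ≤ outerCandidate x z := by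
  have h := innerCandidate_le hψ_cont hψ_zero hψ_incr hδ hx hx1 hxδ hz hz1
  have hpos : 0 < ‖z 1‖ := by linarith [div_pos hx four_pos]
  have hl := log_four_div_pos hx hx1
  -- The excess of the exponent over 2 is chosen so that `(x/4)` raised to it is exactly `1/e`,
  -- uniformly in `x`.
  have h1 : 1 / 3 ≤ ‖z 1‖ ^ (Real.log (4 / x))⁻¹ := by
    have e1 : (x / 4) ^ (Real.log (4 / x))⁻¹ = Real.exp (-1) := by
      rw [Real.rpow_def_of_pos (by positivity)]
      congr 1
      have : Real.log (x / 4) = -Real.log (4 / x) := by rw [← Real.log_inv, inv_div]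
      rw [this, neg_mul, mul_inv_cancel₀ hl.ne']
    have e2 : (x / 4) ^ (Real.log (4 / x))⁻¹ ≤ ‖z 1‖ ^ (Real.log (4 / x))⁻¹ :=
      Real.rpow_le_rpow (by positivity) hz4 (inv_pos.2 hl).le
    rw [e1, Real.exp_neg] at e2
    refine le_trans ?_ e2
    rw [one_div]
    exact inv_anti₀ (Real.exp_pos 1) (by linarith [Real.exp_one_lt_d9])
  rw [outerCandidate, outerExponent, Real.rpow_add hpos, Real.rpow_two]
  nlinarith [sq_nonneg ‖z 1‖, mul_le_mul_of_nonneg_left h1 (sq_nonneg ‖z 1‖)]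

theorem candidate_eq_outerCandidate {z : Fin 2 → ℂ} (hz : z ∈ modelDomain ψ)
    (hz4 : x / 4 ≤ ‖z 1‖) : candidate x δ z = outerCandidate x z := by
  unfold candidate
  split_ifs with h
  · exact max_eq_right
      (innerCandidate_le_outerCandidate hψ_cont hψ_zero hψ_incr hδ hx hx1 hxδ hz h hz4)
  · rfl

theorem candidate_le_one {z : Fin 2 → ℂ} (hz : z ∈ modelDomain ψ) : candidate x δ z ≤ 1 := by
  have hout : outerCandidate x z ≤ 1 := Real.rpow_le_one (norm_nonneg _) hz.2.1.le
    (by linarith [two_lt_outerExponent hx hx1])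
  unfold candidate
  split_ifs with h
  · refine max_le ((innerCandidate_le hψ_cont hψ_zero hψ_incr hδ hx hx1 hxδ hz h).trans ?_) hout
    nlinarith [hz.2.1, norm_nonneg (z 1)]
  · exact hout

theorem continuousOn_candidate : ContinuousOn (candidate x δ) (modelDomain ψ) := by
  have hnorm : Continuous fun z : Fin 2 → ℂ => ‖z 1‖ := by fun_prop
  have hout := continuous_outerCandidate hx hx1
  intro z hz
  rcases lt_or_ge ‖z 1‖ (x / 2) with h | h
  · have hne := sub_ne_zero_of_mem_modelDomain hψ_cont hψ_zero hψ_incr hδ hx hx1 hxδ hz h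
    have hin : ContinuousAt (innerCandidate x δ) z := by
      have h0 : ContinuousAt (fun z : Fin 2 → ℂ => z 0) z := (continuous_apply 0).continuousAt
      have h1 : ContinuousAt (fun z : Fin 2 → ℂ => z 1) z := (continuous_apply 1).continuousAt
      exact ((continuousAt_const.mul h1).norm.pow 2).add ((continuousAt_const.mul
        ((h0.add continuousAt_const).div (h0.sub continuousAt_const) hne)).norm.pow 2)
    refine ContinuousAt.continuousWithinAt
      (ContinuousAt.congr (f := fun z => max (innerCandidate x δ z) (outerCandidate x z))
        (hin.max hout.continuousAt) ?_)
    filter_upwards [(isOpen_lt hnorm continuous_const).mem_nhds h] with w hw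
    exact (if_pos hw).symm
  · have h4 : x / 4 < ‖z 1‖ := by linarith
    refine hout.continuousWithinAt.congr_of_eventuallyEq ?_
      (candidate_eq_outerCandidate hψ_cont hψ_zero hψ_incr hδ hx hx1 hxδ hz h4.le)
    filter_upwards [self_mem_nhdsWithin, nhdsWithin_le_nhds
      ((isOpen_lt continuous_const hnorm).mem_nhds h4)] with w hw hw4
    exact candidate_eq_outerCandidate hψ_cont hψ_zero hψ_incr hδ hx hx1 hxδ hw (le_of_lt hw4)

/-- At each point of a disc one of two minorants touches the candidate: `|z₂|^k`, which is a
minorant everywhere, or the inner sum of squares, which is one near any point with `|z₂| < x/2`.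
Either gives the sub-mean value inequality. -/
theorem plurisubharmonicOn_log_candidate :
    PlurisubharmonicOn (fun z => ENNReal.log (ENNReal.ofReal (candidate x δ z)))
      (modelDomain ψ) := by
  have hcont : ContinuousOn (fun z => ENNReal.log (ENNReal.ofReal (candidate x δ z)))
      (modelDomain ψ) := ENNReal.continuous_log.comp_continuousOn
    (ENNReal.continuous_ofReal.comp_continuousOn
      (continuousOn_candidate hψ_cont hψ_zero hψ_incr hδ hx hx1 hxδ))
  refine ⟨hcont.upperSemicontinuousOn, fun φ hφ => ⟨?_, ?_, ?_⟩⟩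
  · exact (hcont.comp hφ.1.continuousOn hφ.2).upperSemicontinuousOn
  · intro a _
    simp only [Function.comp_apply, ne_eq, ENNReal.log_eq_top_iff]
    exact ENNReal.ofReal_ne_top
  intro a ha
  have hφan : ∀ i, AnalyticAt ℂ (fun z => φ z i) a := fun i =>
    (differentiableOn_pi.1 hφ.1 i).analyticAt (isOpen_ball.mem_nhds ha)
  have hk := two_lt_outerExponent hx hx1
  have hout : candidate x δ (φ a) ≤ ‖φ a 1‖ ^ outerExponent x →
      ∃ ρ > 0, ∀ r, 0 < r → r < ρ → ENNReal.log (ENNReal.ofReal (candidate x δ (φ a))) ≤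
        circleMean (fun z => ENNReal.log (ENNReal.ofReal (candidate x δ (φ z)))) a r := fun h =>
    exists_log_le_circleMean_of_rpow_le (v := fun z => candidate x δ (φ z)) (by linarith)
      (hφan 1) h (Eventually.of_forall fun z => outerCandidate_le_candidate x δ (φ z))
  rcases le_or_gt (x / 4) ‖φ a 1‖ with h4 | h4
  · exact hout (candidate_eq_outerCandidate hψ_cont hψ_zero hψ_incr hδ hx hx1 hxδ (hφ.2 ha) h4).le
  have h2 : ‖φ a 1‖ < x / 2 := by linarith
  rcases le_total (innerCandidate x δ (φ a)) (outerCandidate x (φ a)) with hle | hle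
  · refine hout (le_of_eq ?_)
    rw [candidate, if_pos h2, max_eq_right hle, outerCandidate]
  have hne := sub_ne_zero_of_mem_modelDomain hψ_cont hψ_zero hψ_incr hδ hx hx1 hxδ (hφ.2 ha) h2
  refine exists_log_le_circleMean_of_sq_add_sq_le (v := fun z => candidate x δ (φ z))
    (g := fun z => innerFst (φ z)) (h := fun z => innerSnd x δ (φ z))
    (analyticAt_const.mul (hφan 1))
    (analyticAt_const.mul (((hφan 0).add analyticAt_const).div
      ((hφan 0).sub analyticAt_const) hne)) ?_ ?_
  · rw [candidate, if_pos h2, max_eq_left hle, innerCandidate]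
  · filter_upwards [(hφan 1).continuousAt.norm.eventually_lt_const h2] with z hz
    rw [candidate, if_pos hz]
    exact le_max_left _ _

omit hψ_cont hψ_zero hψ_incr hδ hxδ in
-- The outer exponent exceeds 2, so for small `z₂` the outer function is below `|z₂|²/16`. This
-- gives the smoothness of the maximum at the base point.
theorem candidate_eventuallyEq_innerCandidate :
    candidate x δ =ᶠ[𝓝 (basePoint δ)] innerCandidate x δ := by
  have hl := inv_pos.2 (log_four_div_pos hx hx1)
  have hnorm : Tendsto (fun z : Fin 2 → ℂ => ‖z 1‖) (𝓝 (basePoint δ)) (𝓝 0) := by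
    have : Continuous fun z : Fin 2 → ℂ => ‖z 1‖ := by fun_prop
    exact this.tendsto' _ _ (by simp [basePoint])
  have hpow : Tendsto (fun z : Fin 2 → ℂ => ‖z 1‖ ^ (Real.log (4 / x))⁻¹) (𝓝 (basePoint δ))
      (𝓝 0) := by
    have := hnorm.rpow_const (p := (Real.log (4 / x))⁻¹) (Or.inr hl.le)
    rwa [Real.zero_rpow hl.ne'] at this
  filter_upwards [hnorm.eventually_lt_const (half_pos hx),
    hpow.eventually_lt_const (by norm_num : (0 : ℝ) < 1 / 16)] with z hz1 hz2
  rw [candidate, if_pos hz1]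
  refine max_eq_left ?_
  rw [innerCandidate_eq hx, outerCandidate, outerExponent,
    Real.rpow_add_of_nonneg (norm_nonneg _) two_pos.le hl.le, Real.rpow_two]
  have h1 : 0 ≤ x ^ 2 / 1600 * ‖(z 0 + δ) / (z 0 - δ)‖ ^ 2 := by positivity
  nlinarith [mul_le_mul_of_nonneg_left hz2.le (sq_nonneg ‖z 1‖)]

omit hψ_cont hψ_zero hψ_incr hx hx1 hxδ in
theorem contDiffAt_innerCandidate : ContDiffAt ℝ 2 (innerCandidate x δ) (basePoint δ) := by
  have h0 : ContDiffAt ℝ 2 (fun z : Fin 2 → ℂ => z 0) (basePoint δ) :=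
    (contDiff_apply ℝ ℂ (0 : Fin 2)).contDiffAt
  have h1 : ContDiffAt ℝ 2 (fun z : Fin 2 → ℂ => z 1) (basePoint δ) :=
    (contDiff_apply ℝ ℂ (1 : Fin 2)).contDiffAt
  have hne : basePoint δ 0 - δ ≠ 0 := by
    have : basePoint δ 0 - δ = ((-δ - δ : ℝ) : ℂ) := by simp [basePoint]
    rw [this, Complex.ofReal_ne_zero]
    linarith
  have h2 := (h0.add (contDiffAt_const (c := (δ : ℂ)))).mul
    ((h0.sub (contDiffAt_const (c := (δ : ℂ)))).inv hne)
  have h3 := ((contDiffAt_const (c := (1 / 4 : ℂ))).mul h1).norm_sq ℝ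
  have h4 := ((contDiffAt_const (c := (x / 40 : ℂ))).mul h2).norm_sq ℝ
  exact h3.add h4

theorem sibonyAdmissible_candidate :
    SibonyAdmissible (modelDomain ψ) (basePoint δ) (candidate x δ) where
  nonneg z _ := (outerCandidate_nonneg x z).trans (outerCandidate_le_candidate x δ z)
  le_one z hz := candidate_le_one hψ_cont hψ_zero hψ_incr hδ hx hx1 hxδ hz
  apply_eq_zero := by
    rw [(candidate_eventuallyEq_innerCandidate hx hx1).self_of_nhds]
    simp [innerCandidate, innerFst, innerSnd, basePoint]
  contDiffAt := (contDiffAt_innerCandidate hδ).congr_of_eventuallyEq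
    (candidate_eventuallyEq_innerCandidate hx hx1)
  log_psh := plurisubharmonicOn_log_candidate hψ_cont hψ_zero hψ_incr hδ hx hx1 hxδ

theorem leviForm_candidate (hδ1 : δ < 1) (X : Fin 2 → ℂ) :
    leviForm (candidate x δ) (basePoint δ) X =
      ‖X 1‖ ^ 2 / 16 + x ^ 2 / 1600 * (‖X 0‖ ^ 2 / (4 * δ ^ 2)) := by
  have hu := sibonyAdmissible_candidate hψ_cont hψ_zero hψ_incr hδ hx hx1 hxδ
  have hpos := hu.eventually_nonneg (isOpen_modelDomain hψ_cont)
    (basePoint_mem_modelDomain hψ_zero hδ hδ1)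
  have hQ : ∀ Y : Fin 2 → ℂ,
      fderiv ℝ (fderiv ℝ (candidate x δ)) (basePoint δ) Y Y / 2 =
        ‖Y 1‖ ^ 2 / 16 + x ^ 2 / 1600 * (‖Y 0‖ ^ 2 / (4 * δ ^ 2)) := by
    intro Y
    have hγ : HasDerivAt (fun t : ℝ => basePoint δ + t • Y) Y 0 := by
      simpa using ((hasDerivAt_id (0 : ℝ)).smul_const Y).const_add (basePoint δ)
    have hlim := tendsto_taylor_two hu.contDiffAt hu.apply_eq_zero hpos hγ (by simp)
    refine tendsto_nhds_unique hlim ?_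
    have hcont : ContinuousAt (fun t : ℝ => ‖Y 1‖ ^ 2 / 16 +
        x ^ 2 / 1600 * (‖Y 0‖ ^ 2 / ‖(t : ℂ) * Y 0 - 2 * δ‖ ^ 2)) 0 := by
      have : ‖((0 : ℝ) : ℂ) * Y 0 - 2 * δ‖ ^ 2 ≠ 0 := by
        simpa using hδ.ne'
      fun_prop (disch := assumption)
    have h0 := hcont.tendsto.mono_left (nhdsWithin_le_nhds (s := {0}ᶜ))
    have hval : ‖((0 : ℝ) : ℂ) * Y 0 - 2 * δ‖ ^ 2 = 4 * δ ^ 2 := by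
      rw [Complex.ofReal_zero, zero_mul, zero_sub, norm_neg, norm_mul, Complex.norm_real,
        Real.norm_of_nonneg hδ.le, Complex.norm_ofNat]
      ring
    rw [hval] at h0
    refine h0.congr' ?_
    have htend : Tendsto (fun t : ℝ => basePoint δ + t • Y) (𝓝[≠] 0) (𝓝 (basePoint δ)) := by
      simpa using hγ.continuousAt.tendsto.mono_left (nhdsWithin_le_nhds (s := {0}ᶜ))
    filter_upwards [htend.eventually (candidate_eventuallyEq_innerCandidate hx hx1),
      self_mem_nhdsWithin] with t ht ht0
    have ht0' : t ≠ 0 := ht0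
    rw [ht, innerCandidate_eq hx]
    have e1 : (basePoint δ + t • Y) 1 = (t : ℂ) * Y 1 := by simp [basePoint]
    have e2 : (basePoint δ + t • Y) 0 + δ = (t : ℂ) * Y 0 := by simp [basePoint]
    have e3 : (basePoint δ + t • Y) 0 - δ = (t : ℂ) * Y 0 - 2 * δ := by
      simp [basePoint]; ring
    rw [e1, e2, e3, norm_div, norm_mul, norm_mul, Complex.norm_real, Real.norm_eq_abs, div_pow,
      mul_pow, mul_pow, sq_abs]
    field_simp
  -- The quadratic form depends only on `|Y₀|` and `|Y₁|`, so `X` and `iX` contribute equally.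
  have h1 := hQ X
  have h2 := hQ (Complex.I • X)
  simp only [Pi.smul_apply, smul_eq_mul, norm_mul, Complex.norm_I, one_mul] at h2
  rw [leviForm_eq hu.contDiffAt, leviBilin_apply]
  linarith

theorem ofReal_le_sibony_modelDomain (hδ1 : δ < 1) (xN xT : ℂ) :
    ENNReal.ofReal (1 / 200 * (x / δ * ‖xN‖ + ‖xT‖)) ≤
      sibony (modelDomain ψ) (basePoint δ) ![xN, xT] := by
  refine le_iSup₂_of_le (candidate x δ)
    (sibonyAdmissible_candidate hψ_cont hψ_zero hψ_incr hδ hx hx1 hxδ) ?_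
  refine ENNReal.ofReal_le_ofReal (Real.le_sqrt_of_sq_le ?_)
  rw [leviForm_candidate hψ_cont hψ_zero hψ_incr hδ hx hx1 hxδ hδ1]
  change _ ≤ ‖xT‖ ^ 2 / 16 + x ^ 2 / 1600 * (‖xN‖ ^ 2 / (4 * δ ^ 2))
  have : x ^ 2 / 1600 * (‖xN‖ ^ 2 / (4 * δ ^ 2)) = (x / δ * ‖xN‖) ^ 2 / 6400 := by
    field_simp; ring
  rw [this]
  nlinarith [sq_nonneg (x / δ * ‖xN‖ - ‖xT‖), sq_nonneg (x / δ * ‖xN‖), sq_nonneg ‖xT‖]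

end Lower

end InvMetric

end

theorem theorem1 (ψ : ℝ → ℝ) (hψ_cont : ContinuousOn ψ (Set.Icc 0 1))
    (hψ_nonneg : ∀ x ∈ Set.Icc (0 : ℝ) 1, 0 ≤ ψ x) (hψ_zero : ψ 0 = 0) (hψ_one : 0 < ψ 1)
    (hψ_incr : MonotoneOn (fun x => ψ x / x) (Set.Ioo 0 1))
    (δ₀ : ℝ) (hδ₀ : δ₀ < 1) :
    ∃ c C : ℝ, 0 < c ∧ c < C ∧
      ∀ δ : ℝ, 0 < δ → δ ≤ δ₀ → δ ≤ ψ 1 → ∀ xN xT : ℂ,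
        ENNReal.ofReal (c * InvMetric.modelSize ψ δ xN xT) ≤
            InvMetric.sibony (InvMetric.modelDomain ψ) (InvMetric.basePoint δ) ![xN, xT] ∧
        (InvMetric.sibony (InvMetric.modelDomain ψ) (InvMetric.basePoint δ) ![xN, xT] ≤
            InvMetric.kobayashiSum 2 (InvMetric.modelDomain ψ) (InvMetric.basePoint δ)
              ![xN, xT] ∧
          InvMetric.kobayashiSum 2 (InvMetric.modelDomain ψ) (InvMetric.basePoint δ)
              ![xN, xT] ≤
            ENNReal.ofReal (C * InvMetric.modelSize ψ δ xN xT)) ∧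
        (InvMetric.sibony (InvMetric.modelDomain ψ) (InvMetric.basePoint δ) ![xN, xT] ≤
            InvMetric.kobayashiTilde (InvMetric.modelDomain ψ) (InvMetric.basePoint δ)
              ![xN, xT] ∧
          InvMetric.kobayashiTilde (InvMetric.modelDomain ψ) (InvMetric.basePoint δ)
              ![xN, xT] ≤
            ENNReal.ofReal (C * InvMetric.modelSize ψ δ xN xT)) := by
  -- With `b = k δ / x`, the bound `k ≤ 1` gives `b x ≤ δ`; the other entry, with `δ/x ≤ ψ(1)`,
  -- gives `b ≤ 1 - δ₀`, which keeps the affine discs inside `|z₁| < 1`.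
  set k : ℝ := min 1 ((1 - δ₀) / ψ 1) with hk
  have hkpos : 0 < k := lt_min one_pos (div_pos (by linarith) hψ_one)
  have hk1 : k ≤ 1 := min_le_left _ _
  have hkψ : k * ψ 1 ≤ 1 - δ₀ := (le_div_iff₀ hψ_one).1 (min_le_right _ _)
  have hC : 2 ≤ 2 / k := by rw [le_div_iff₀ hkpos]; linarith
  refine ⟨1 / 200, 2 / k, by norm_num, by linarith, fun δ hδ hδδ₀ hδψ xN xT => ?_⟩
  obtain ⟨hx, hx1, hxδ⟩ := InvMetric.profileInv_spec hψ_cont hψ_zero hδ hδψ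
  unfold InvMetric.modelSize
  set x := InvMetric.profileInv ψ δ
  have hδ1 : δ < 1 := by linarith
  have hopen := InvMetric.isOpen_modelDomain hψ_cont
  have hmem := InvMetric.basePoint_mem_modelDomain hψ_zero hδ hδ1
  set b : ℝ := k * δ / x with hb
  have hbpos : 0 < b := by positivity
  have hbx : b * x ≤ δ := by
    rw [hb, div_mul_cancel₀ _ hx.ne']
    nlinarith
  have hbδ : δ + b ≤ 1 := by
    have h1 := InvMetric.profile_mul_le hψ_cont hψ_incr hx hx1 le_rfl
    rw [hxδ, mul_one] at h1
    have h2 : b ≤ k * ψ 1 := by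
      rw [hb, div_le_iff₀ hx, mul_assoc]
      exact mul_le_mul_of_nonneg_left h1 hkpos.le
    linarith
  have hN : 2 * ‖xN‖ / b = 2 / k * (x / δ * ‖xN‖) := by
    rw [hb]; field_simp
  have hT := mul_le_mul_of_nonneg_right hC (norm_nonneg xT)
  have hT0 := norm_nonneg xT
  refine ⟨InvMetric.ofReal_le_sibony_modelDomain hψ_cont hψ_zero hψ_incr hδ hx hx1 hxδ hδ1 xN xT,
    ⟨InvMetric.sibony_le_kobayashiSum_two hopen hmem _,
      (InvMetric.kobayashiSum_modelDomain_le hψ_cont hψ_nonneg hψ_zero hψ_incr hδ hx hxδ hbpos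
        hbx hbδ xN xT).trans (ENNReal.ofReal_le_ofReal ?_)⟩,
    InvMetric.sibony_le_kobayashiTilde hopen hmem _,
    (InvMetric.kobayashiTilde_modelDomain_le hψ_cont hψ_nonneg hψ_zero hψ_incr hδ hx hxδ hbpos
      hbx hbδ xN xT).trans (ENNReal.ofReal_le_ofReal ?_)⟩
  · rw [hN, mul_add]; linarith
  · rw [hN, mul_add]; linarith
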